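/- Notation. $T_xg=g(\cdot-x)$ and $M_\xi g=e^{2\pi i\xi\cdot}g$ for $x,\xi\in\mathbb R^n$. Let $\mathcal K_1(\mathbb R^n)$ be the space of all $\varphi\in C^\infty(\mathbb R^n)$ for which the norms $\nu_k(\varphi)=\sup_{t\in\mathbb R^n,\,|\alpha|\le k}e^{k|t|}|\varphi^{(\alpha)}(t)|$, $k\in\mathbb N_0$, are all finite, with the topology given by these norms, and let $\mathcal K_1'(\mathbb R^n)$ be its strong dual. Translations act on $\mathcal K_1'(\mathbb R^n)$ by $\langle T_hf,\varphi\rangle=\langle f,T_{-h}\varphi\rangle$. The short-time Fourier transform of $f\in\mathcal K_1'(\mathbb R^n)$ with window $\psi\in\mathcal K_1(\mathbb R^n)$ is $V_\psi f(x,\xi)=\langle f,\overline{M_\xi T_x\psi}\rangle$, $x,\xi\in\mathbb R^n$. Let $\omega:\mathbb R^n\to(0,\infty)$ be an exponentially moderate weight, that is, $\omega$ is measurable and there are $A>0$, $a\ge0$ with $\omega(x+y)\le A\,\omega(y)e^{a|x|}$ for all $x,y\in\mathbb R^n$. Let $\mathcal D_{L^1_\omega}(\mathbb R^n)$ be the space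 of all $\varphi\in C^\infty(\mathbb R^n)$ for which the norms $\|\varphi\|_{1,\omega,k}=\sup_{|\alpha|\le k}\int_{\mathbb R^n}|\varphi^{(\alpha)}(t)|\,\omega(t)\,dt$, $k\in\mathbb N_0$, are all finite, with the topology given by these norms, and let $\mathcal B'_\omega(\mathbb R^n)$ be its strong dual. As $\mathcal K_1(\mathbb R^n)$ is continuously and densely included in $\mathcal D_{L^1_\omega}(\mathbb R^n)$, restriction to $\mathcal K_1(\mathbb R^n)$ identifies $\mathcal B'_\omega(\mathbb R^n)$ with a subspace of $\mathcal K_1'(\mathbb R^n)$. Each $\phi\in\mathcal D(\mathbb R^n)=C_c^\infty(\mathbb R^n)$ is regarded as the element $\theta\mapsto\int\phi\,\theta\,dt$ of $\mathcal B'_\omega(\mathbb R^n)$, and $\dot{\mathcal B}'_\omega(\mathbb R^n)$ denotes the closure of $\mathcal D(\mathbb R^n)$ in $\mathcal B'_\omega(\mathbb R^n)$. Theorem. Let $f\in\mathcal K_1'(\mathbb R^n)$ and $\psi\in\mathcal K_1(\mathbb R^n)\setminus\{0\}$. (i) The following statements are equivalent: (a) $f\in\mathcal B'_\omega(\mathbb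 R^n)$; (b) the set $\{T_{-h}f/\omega(h):h\in\mathbb R^n\}$ is bounded in $\mathcal K_1'(\mathbb R^n)$; (c) there is $s\in\mathbb R$ such that $$\sup_{(x,\xi)\in\mathbb R^{2n}}(1+|\xi|)^{-s}\,\frac{|V_\psi f(x,\xi)|}{\omega(x)}<\infty.$$ (ii) The following statements are equivalent: (a)$'$ $f\in\dot{\mathcal B}'_\omega(\mathbb R^n)$; (b)$'$ $\lim_{|h|\to\infty}T_{-h}f/\omega(h)=0$ in $\mathcal K_1'(\mathbb R^n)$; (c)$'$ there is $s'\in\mathbb R$ such that $$\lim_{|(x,\xi)|\to\infty}(1+|\xi|)^{-s'}\,\frac{|V_\psi f(x,\xi)|}{\omega(x)}=0.$$ -/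

import Mathlib

open MeasureTheory Filter Topology Complex
open scoped NNReal Distributions

noncomputable section

/-- `ℝⁿ` with its Euclidean norm. -/
abbrev Rn (n : ℕ) : Type := EuclideanSpace ℝ (Fin n)

/-! ### The space `𝒦₁(ℝⁿ)` of exponentially rapidly decreasing smooth functions -/

section Aux

variable {n : ℕ}

lemma iteratedFDeriv_add_eq {f g : Rn n → ℂ} (hf : ContDiff ℝ (⊤ : ℕ∞) f) (hg : ContDiff ℝ (⊤ : ℕ∞) g)
    (m : ℕ) (t : Rn n) :
    iteratedFDeriv ℝ m (f + g) t = iteratedFDeriv ℝ m f t + iteratedFDeriv ℝ m g t :=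
  iteratedFDeriv_add_apply (hf.contDiffAt.of_le (mod_cast le_top))
    (hg.contDiffAt.of_le (mod_cast le_top))

lemma iteratedFDeriv_smul_eq {f : Rn n → ℂ} (hf : ContDiff ℝ (⊤ : ℕ∞) f) (c : ℂ)
    (m : ℕ) (t : Rn n) :
    iteratedFDeriv ℝ m (c • f) t = c • iteratedFDeriv ℝ m f t :=
  iteratedFDeriv_const_smul_apply (hf.contDiffAt.of_le (mod_cast le_top))

end Aux

/-- The underlying vector space of `𝒦₁(ℝⁿ)`: smooth functions `φ : ℝⁿ → ℂ` with
`sup_t e^{k|t|} ‖D^m φ(t)‖ < ∞` for all `k, m`.  As usual in Mathlib, the `m`-th order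
derivatives are measured together, through the operator norm of the `m`-th Fréchet derivative;
this norm is equivalent to the maximum of the partial derivatives `|φ^{(α)}(t)|`, `|α| = m`. -/
def K1.submodule (n : ℕ) : Submodule ℂ (Rn n → ℂ) where
  carrier := {φ | ContDiff ℝ (⊤ : ℕ∞) φ ∧ ∀ k m : ℕ, ∃ C : ℝ, ∀ t : Rn n,
    Real.exp (k * ‖t‖) * ‖iteratedFDeriv ℝ m φ t‖ ≤ C}
  zero_mem' := ⟨contDiff_const, fun k m => ⟨0, fun t => by simp⟩⟩
  add_mem' := by
    rintro f g ⟨hf, hf'⟩ ⟨hg, hg'⟩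
    refine ⟨hf.add hg, fun k m => ?_⟩
    obtain ⟨C, hC⟩ := hf' k m
    obtain ⟨C', hC'⟩ := hg' k m
    refine ⟨C + C', fun t => ?_⟩
    rw [iteratedFDeriv_add_eq hf hg]
    have h := norm_add_le (iteratedFDeriv ℝ m f t) (iteratedFDeriv ℝ m g t)
    have := hC t
    have := hC' t
    nlinarith [Real.exp_pos (k * ‖t‖)]
  smul_mem' := by
    rintro c f ⟨hf, hf'⟩
    refine ⟨contDiff_const.smul hf, fun k m => ?_⟩
    obtain ⟨C, hC⟩ := hf' k m
    refine ⟨‖c‖ * C, fun t => ?_⟩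
    rw [iteratedFDeriv_smul_eq hf, norm_smul, mul_left_comm]
    exact mul_le_mul_of_nonneg_left (hC t) (norm_nonneg c)

/-- The Hasumi–Silva space `𝒦₁(ℝⁿ)`. -/
def K1 (n : ℕ) : Type := K1.submodule n

namespace K1

variable {n : ℕ}

instance : AddCommGroup (K1 n) := inferInstanceAs (AddCommGroup (K1.submodule n))

instance : Module ℂ (K1 n) := inferInstanceAs (Module ℂ (K1.submodule n))

instance : FunLike (K1 n) (Rn n) ℂ where
  coe φ := φ.1
  coe_injective _ _ h := Subtype.ext h

lemma smooth (φ : K1 n) : ContDiff ℝ (⊤ : ℕ∞) φ := φ.2.1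

lemma decay (φ : K1 n) (k m : ℕ) :
    ∃ C : ℝ, ∀ t : Rn n, Real.exp (k * ‖t‖) * ‖iteratedFDeriv ℝ m φ t‖ ≤ C := φ.2.2 k m

lemma coe_add (φ ψ : K1 n) : ⇑(φ + ψ) = ⇑φ + ⇑ψ := rfl

lemma coe_smul (c : ℂ) (φ : K1 n) : ⇑(c • φ) = c • ⇑φ := rfl

lemma bddAbove (φ : K1 n) (k m : ℕ) :
    BddAbove (Set.range fun t : Rn n => Real.exp (k * ‖t‖) * ‖iteratedFDeriv ℝ m φ t‖) := by
  obtain ⟨C, hC⟩ := φ.decay k m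
  exact ⟨C, by rintro _ ⟨t, rfl⟩; exact hC t⟩

/-- `sup_t e^{k|t|} ‖D^m φ(t)‖`. -/
def nuAux (n k m : ℕ) : Seminorm ℂ (K1 n) :=
  Seminorm.of (fun φ => ⨆ t : Rn n, Real.exp (k * ‖t‖) * ‖iteratedFDeriv ℝ m φ t‖)
    (fun φ ψ => by
      refine ciSup_le fun t => ?_
      rw [coe_add, iteratedFDeriv_add_eq φ.smooth ψ.smooth]
      have h1 := le_ciSup (φ.bddAbove k m) t
      have h2 := le_ciSup (ψ.bddAbove k m) t
      have h := norm_add_le (iteratedFDeriv ℝ m φ t) (iteratedFDeriv ℝ m ψ t)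
      nlinarith [Real.exp_pos (k * ‖t‖)])
    (fun c φ => by
      rw [Real.mul_iSup_of_nonneg (norm_nonneg c)]
      refine iSup_congr fun t => ?_
      rw [coe_smul, iteratedFDeriv_smul_eq φ.smooth, norm_smul, mul_left_comm])

lemma le_nuAux (φ : K1 n) (k m : ℕ) (t : Rn n) :
    Real.exp (k * ‖t‖) * ‖iteratedFDeriv ℝ m φ t‖ ≤ nuAux n k m φ :=
  le_ciSup (φ.bddAbove k m) t

/-- The norm `ν_k(φ) = max_{m ≤ k} sup_t e^{k|t|} ‖D^m φ(t)‖` of `𝒦₁(ℝⁿ)`. -/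
def nu (n : ℕ) : SeminormFamily ℂ (K1 n) ℕ :=
  fun k => (Finset.range (k + 1)).sup (nuAux n k)

/-- `𝒦₁(ℝⁿ)` carries the topology defined by the norms `ν_k`. -/
instance : TopologicalSpace (K1 n) := (nu n).moduleFilterBasis.topology'

lemma withSeminorms (n : ℕ) : WithSeminorms (nu n) := ⟨rfl⟩

instance : IsTopologicalAddGroup (K1 n) := (withSeminorms n).topologicalAddGroup

instance : ContinuousSMul ℂ (K1 n) := (withSeminorms n).continuousSMul

lemma nuAux_le_nu {k m : ℕ} (h : m ≤ k) (φ : K1 n) : nuAux n k m φ ≤ nu n k φ := by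
  have : nuAux n k m ≤ nu n k :=
    Finset.le_sup (f := nuAux n k) (Finset.mem_range.2 (Nat.lt_succ_of_le h))
  exact this φ

/-- The translation `T_h φ = φ(· - h)` on `𝒦₁(ℝⁿ)`. -/
def translateLM (h : Rn n) : K1 n →ₗ[ℂ] K1 n where
  toFun φ := ⟨fun t => φ (t - h), φ.smooth.comp (contDiff_id.sub contDiff_const), fun k m => by
    obtain ⟨C, hC⟩ := φ.decay k m
    refine ⟨Real.exp (k * ‖h‖) * C, fun t => ?_⟩
    rw [iteratedFDeriv_comp_sub]
    refine le_trans ?_ (mul_le_mul_of_nonneg_left (hC (t - h)) (Real.exp_pos _).le)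
    rw [← mul_assoc, ← Real.exp_add, ← mul_add]
    gcongr
    calc ‖t‖ = ‖h + (t - h)‖ := by congr 1; abel
      _ ≤ _ := norm_add_le _ _⟩
  map_add' φ ψ := rfl
  map_smul' c φ := rfl

/-- The translation `T_h φ = φ(· - h)`, as a continuous operator on `𝒦₁(ℝⁿ)`. -/
def translate (h : Rn n) : K1 n →L[ℂ] K1 n where
  toLinearMap := translateLM h
  cont := by
    refine WithSeminorms.continuous_of_isBounded (withSeminorms n) (withSeminorms n)
      (translateLM h) fun k => ?_
    refine ⟨{k}, ⟨Real.exp (k * ‖h‖), (Real.exp_pos _).le⟩, ?_⟩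
    intro φ
    rw [Finset.sup_singleton]
    change nu n k _ ≤ Real.exp (k * ‖h‖) * nu n k φ
    refine Seminorm.finset_sup_apply_le
      (mul_nonneg (Real.exp_pos _).le (apply_nonneg _ _)) fun m hm => ?_
    refine le_trans ?_ (mul_le_mul_of_nonneg_left
      (nuAux_le_nu (Nat.le_of_lt_succ (Finset.mem_range.1 hm)) φ) (Real.exp_pos _).le)
    refine ciSup_le fun t => ?_
    change Real.exp (k * ‖t‖) * ‖iteratedFDeriv ℝ m (fun t => φ (t - h)) t‖ ≤ _
    rw [iteratedFDeriv_comp_sub]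
    refine le_trans ?_ (mul_le_mul_of_nonneg_left (le_nuAux φ k m (t - h)) (Real.exp_pos _).le)
    rw [← mul_assoc, ← Real.exp_add, ← mul_add]
    gcongr
    calc ‖t‖ = ‖h + (t - h)‖ := by congr 1; abel
      _ ≤ _ := norm_add_le _ _

/-- The complex exponential `t ↦ e^{2πi ξ·t}`. -/
def character (ξ : Rn n) (t : Rn n) : ℂ := cexp (2 * Real.pi * I * (inner ℝ ξ t : ℝ))

lemma character_smooth (ξ : Rn n) : ContDiff ℝ (⊤ : ℕ∞) (character ξ) := by
  unfold character
  refine Complex.contDiff_exp.comp (contDiff_const.mul ?_)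
  exact Complex.ofRealCLM.contDiff.comp (contDiff_const.inner ℝ contDiff_id)

lemma character_bound (ξ : Rn n) (m : ℕ) :
    ∃ C : ℝ, ∀ t : Rn n, ‖iteratedFDeriv ℝ m (character ξ) t‖ ≤ C := by
  have hg : ContDiff ℝ (⊤ : ℕ∞) (fun s : ℝ => cexp (2 * Real.pi * I * s)) :=
    Complex.contDiff_exp.comp (contDiff_const.mul Complex.ofRealCLM.contDiff)
  have hd : ∀ j : ℕ, iteratedDeriv j (fun s : ℝ => cexp (2 * Real.pi * I * s)) =
      fun s : ℝ => (2 * Real.pi * I) ^ j * cexp (2 * Real.pi * I * s) := by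
    intro j
    induction j with
    | zero => simp
    | succ j ih =>
      rw [iteratedDeriv_succ, ih]
      funext s
      have h : HasDerivAt (fun s : ℝ => cexp (2 * Real.pi * I * s))
          (cexp (2 * Real.pi * I * s) * (2 * Real.pi * I)) s := by
        have h' := ((hasDerivAt_id s).ofReal_comp.const_mul (2 * Real.pi * I : ℂ)).cexp
        simpa using h'
      rw [(h.const_mul _).deriv]
      ring
  refine ⟨‖(2 * Real.pi * I : ℂ) ^ m‖ * ∏ _i : Fin m, ‖innerSL ℝ ξ‖, fun t => ?_⟩
  have hc : character ξ = (fun s : ℝ => cexp (2 * Real.pi * I * s)) ∘ (innerSL ℝ ξ) := rfl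
  rw [hc, (innerSL ℝ ξ).iteratedFDeriv_comp_right hg t (mod_cast le_top)]
  refine (ContinuousMultilinearMap.norm_compContinuousLinearMap_le _ _).trans ?_
  refine mul_le_mul_of_nonneg_right ?_ (Finset.prod_nonneg fun _ _ => norm_nonneg _)
  rw [norm_iteratedFDeriv_eq_norm_iteratedDeriv, hd, norm_mul]
  have : ‖cexp (2 * Real.pi * I * ((innerSL ℝ ξ t : ℝ) : ℂ))‖ = 1 := by
    rw [show (2 * Real.pi * I * ((innerSL ℝ ξ t : ℝ) : ℂ)) =
      ((2 * Real.pi * innerSL ℝ ξ t : ℝ) : ℂ) * I by push_cast; ring]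
    exact Complex.norm_exp_ofReal_mul_I _
  rw [this, mul_one]

/-- The modulation `M_ξ φ = e^{2πi ξ·} φ` on `𝒦₁(ℝⁿ)`. -/
def modulate (ξ : Rn n) (φ : K1 n) : K1 n :=
  ⟨fun t => character ξ t * φ t, (character_smooth ξ).mul φ.smooth, fun k m => by
    choose C hC using character_bound (n := n) ξ
    refine ⟨∑ i ∈ Finset.range (m + 1), (m.choose i : ℝ) * C i * nuAux n k (m - i) φ,
      fun t => ?_⟩
    have h := norm_iteratedFDeriv_mul_le (𝕜 := ℝ) (character_smooth ξ) φ.smooth t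
      (n := m) (mod_cast le_top)
    refine (mul_le_mul_of_nonneg_left h (Real.exp_pos _).le).trans ?_
    rw [Finset.mul_sum]
    refine Finset.sum_le_sum fun i _ => ?_
    have h1 := le_nuAux φ k (m - i) t
    have h0 : 0 ≤ C i := (norm_nonneg _).trans (hC i t)
    calc _ = (m.choose i : ℝ) * ‖iteratedFDeriv ℝ i (character ξ) t‖ *
          (Real.exp (k * ‖t‖) * ‖iteratedFDeriv ℝ (m - i) φ t‖) := by ring
      _ ≤ _ := by gcongr; exact hC i t⟩

/-- The complex conjugate of an element of `𝒦₁(ℝⁿ)`. -/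
def conj (φ : K1 n) : K1 n :=
  ⟨fun t => (starRingEnd ℂ) (φ t), Complex.conjCLE.contDiff.comp φ.smooth, fun k m => by
    obtain ⟨C, hC⟩ := φ.decay k m
    refine ⟨C, fun t => ?_⟩
    have h := Complex.conjLIE.norm_iteratedFDeriv_comp_left (𝕜 := ℝ) φ t m
    exact (congrArg (Real.exp (k * ‖t‖) * ·) h).le.trans (hC t)⟩

end K1

/-! ### Distributions of exponential type -/

/-- The space `𝒦₁'(ℝⁿ)` of distributions of exponential type, the dual of `𝒦₁(ℝⁿ)`.  Mathlib's
topology on this space is that of uniform convergence on bounded sets, i.e. the strong one. -/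
abbrev K1Dual (n : ℕ) : Type := K1 n →L[ℂ] ℂ

/-- The translate `T_h f` of `f ∈ 𝒦₁'(ℝⁿ)`: `⟨T_h f, φ⟩ = ⟨f, T_{-h} φ⟩`. -/
def K1Dual.translate {n : ℕ} (h : Rn n) (f : K1Dual n) : K1Dual n := f.comp (K1.translate (-h))

/-- The short-time Fourier transform `V_ψ f(x, ξ) = ⟨f, conj (M_ξ T_x ψ)⟩`. -/
def stft {n : ℕ} (ψ : K1 n) (f : K1Dual n) (x ξ : Rn n) : ℂ :=
  f (K1.conj (K1.modulate ξ (K1.translate x ψ)))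

/-! ### `ω`-bounded distributions -/

/-- An exponentially moderate weight on `ℝⁿ`. -/
structure ExpModerateWeight (n : ℕ) where
  toFun : Rn n → ℝ
  pos' : ∀ x, 0 < toFun x
  measurable' : Measurable toFun
  moderate' : ∃ A > 0, ∃ a ≥ 0, ∀ x y, toFun (x + y) ≤ A * toFun y * Real.exp (a * ‖x‖)

instance {n : ℕ} : CoeFun (ExpModerateWeight n) (fun _ => Rn n → ℝ) := ⟨ExpModerateWeight.toFun⟩

/-- The underlying vector space of `𝒟_{L¹_ω}(ℝⁿ)`: smooth functions all of whose derivatives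
are integrable with respect to `ω(t) dt`. -/
def DL1.submodule {n : ℕ} (ω : ExpModerateWeight n) : Submodule ℂ (Rn n → ℂ) where
  carrier := {φ | ContDiff ℝ (⊤ : ℕ∞) φ ∧ ∀ m : ℕ,
    Integrable (fun t : Rn n => ‖iteratedFDeriv ℝ m φ t‖ * ω t)}
  zero_mem' := ⟨contDiff_const, fun m => by simp⟩
  add_mem' := by
    rintro f g ⟨hf, hf'⟩ ⟨hg, hg'⟩
    refine ⟨hf.add hg, fun m => ?_⟩
    refine ((hf' m).add (hg' m)).mono' ?_ (Eventually.of_forall fun t => ?_)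
    · exact (((hf.add hg).continuous_iteratedFDeriv (m := m)
        (mod_cast le_top)).norm.measurable.mul ω.measurable').aestronglyMeasurable
    · rw [Real.norm_of_nonneg (mul_nonneg (norm_nonneg _) (ω.pos' t).le),
        iteratedFDeriv_add_eq hf hg, Pi.add_apply, ← add_mul]
      exact mul_le_mul_of_nonneg_right (norm_add_le _ _) (ω.pos' t).le
  smul_mem' := by
    rintro c f ⟨hf, hf'⟩
    refine ⟨contDiff_const.smul hf, fun m => ?_⟩
    simp_rw [iteratedFDeriv_smul_eq hf, norm_smul, mul_assoc]
    exact (hf' m).const_mul _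

/-- The Fréchet space `𝒟_{L¹_ω}(ℝⁿ)`. -/
def DL1 {n : ℕ} (ω : ExpModerateWeight n) : Type := DL1.submodule ω

namespace DL1

variable {n : ℕ} {ω : ExpModerateWeight n}

instance : AddCommGroup (DL1 ω) := inferInstanceAs (AddCommGroup (DL1.submodule ω))

instance : Module ℂ (DL1 ω) := inferInstanceAs (Module ℂ (DL1.submodule ω))

instance : FunLike (DL1 ω) (Rn n) ℂ where
  coe φ := φ.1
  coe_injective _ _ h := Subtype.ext h

lemma smooth (φ : DL1 ω) : ContDiff ℝ (⊤ : ℕ∞) φ := φ.2.1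

lemma integrable (φ : DL1 ω) (m : ℕ) :
    Integrable (fun t : Rn n => ‖iteratedFDeriv ℝ m φ t‖ * ω t) := φ.2.2 m

lemma coe_add (φ ψ : DL1 ω) : ⇑(φ + ψ) = ⇑φ + ⇑ψ := rfl

lemma coe_smul (c : ℂ) (φ : DL1 ω) : ⇑(c • φ) = c • ⇑φ := rfl

/-- `∫ ‖D^m φ(t)‖ ω(t) dt`. -/
def normAux (ω : ExpModerateWeight n) (m : ℕ) : Seminorm ℂ (DL1 ω) :=
  Seminorm.of (fun φ => ∫ t : Rn n, ‖iteratedFDeriv ℝ m φ t‖ * ω t)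
    (fun φ ψ => by
      rw [← integral_add (φ.integrable m) (ψ.integrable m)]
      refine integral_mono ((φ + ψ).integrable m) ((φ.integrable m).add (ψ.integrable m))
        fun t => ?_
      simp only [coe_add]
      rw [iteratedFDeriv_add_eq φ.smooth ψ.smooth, ← add_mul]
      exact mul_le_mul_of_nonneg_right (norm_add_le _ _) (ω.pos' t).le)
    (fun c φ => by
      rw [← integral_const_mul]
      refine integral_congr_ae (Eventually.of_forall fun t => ?_)
      simp only [coe_smul]
      rw [iteratedFDeriv_smul_eq φ.smooth, norm_smul, mul_assoc])

/-- The norm `‖φ‖_{1,ω,k} = max_{m ≤ k} ∫ ‖D^m φ(t)‖ ω(t) dt`. -/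
def normFamily (ω : ExpModerateWeight n) : SeminormFamily ℂ (DL1 ω) ℕ :=
  fun k => (Finset.range (k + 1)).sup (normAux ω)

/-- `𝒟_{L¹_ω}(ℝⁿ)` carries the topology defined by the norms `‖·‖_{1,ω,k}`. -/
instance : TopologicalSpace (DL1 ω) := (normFamily ω).moduleFilterBasis.topology'

lemma withSeminorms (ω : ExpModerateWeight n) : WithSeminorms (normFamily ω) := ⟨rfl⟩

instance : IsTopologicalAddGroup (DL1 ω) := (withSeminorms ω).topologicalAddGroup

instance : ContinuousSMul ℂ (DL1 ω) := (withSeminorms ω).continuousSMul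

end DL1

namespace ExpModerateWeight

variable {n : ℕ} (ω : ExpModerateWeight n)

/-- For `φ ∈ 𝒦₁` the function `‖D^m φ‖ ω` is dominated by an integrable function. -/
lemma dominated (ω : ExpModerateWeight n) : ∃ (N : ℕ) (B : ℝ), 0 ≤ B ∧
    ∀ (φ : K1 n) (k m : ℕ), N ≤ k → ∀ t, ‖iteratedFDeriv ℝ m φ t‖ * ω t ≤
      B * K1.nuAux n k m φ * (1 + ‖t‖) ^ (-((n + 1 : ℕ) : ℝ)) := by
  obtain ⟨A, hA, a, ha, h⟩ := ω.moderate'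
  refine ⟨⌈a⌉₊ + (n + 1), A * ω 0, mul_nonneg hA.le (ω.pos' 0).le, fun φ k m hk t => ?_⟩
  have h1 : ω t ≤ A * ω 0 * Real.exp (a * ‖t‖) := by simpa using h t 0
  have h2 := K1.le_nuAux φ k m t
  have hk' : a + (n + 1 : ℕ) ≤ k := by
    have := Nat.le_ceil a
    have : ((⌈a⌉₊ + (n + 1) : ℕ) : ℝ) ≤ k := by exact_mod_cast hk
    push_cast at *
    linarith
  have h3 : Real.exp (a * ‖t‖) * (1 + ‖t‖) ^ (n + 1) ≤ Real.exp (k * ‖t‖) := by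
    calc _ ≤ Real.exp (a * ‖t‖) * Real.exp ‖t‖ ^ (n + 1) := by
          gcongr
          linarith [Real.add_one_le_exp ‖t‖]
      _ = Real.exp ((a + (n + 1 : ℕ)) * ‖t‖) := by
          rw [← Real.exp_nat_mul, ← Real.exp_add]
          ring_nf
      _ ≤ _ := by gcongr
  have hp : (0 : ℝ) < (1 + ‖t‖) ^ (n + 1) := by positivity
  rw [Real.rpow_neg (by positivity), Real.rpow_natCast, ← div_eq_mul_inv, le_div_iff₀ hp]
  have hA0 : 0 ≤ A * ω 0 := mul_nonneg hA.le (ω.pos' 0).le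
  calc ‖iteratedFDeriv ℝ m φ t‖ * ω t * (1 + ‖t‖) ^ (n + 1)
      ≤ ‖iteratedFDeriv ℝ m φ t‖ * (A * ω 0 * Real.exp (a * ‖t‖)) * (1 + ‖t‖) ^ (n + 1) := by
        gcongr
    _ = A * ω 0 * ((Real.exp (a * ‖t‖) * (1 + ‖t‖) ^ (n + 1)) * ‖iteratedFDeriv ℝ m φ t‖) := by
        ring
    _ ≤ A * ω 0 * (Real.exp (k * ‖t‖) * ‖iteratedFDeriv ℝ m φ t‖) := by gcongr
    _ ≤ A * ω 0 * K1.nuAux n k m φ := by gcongr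

lemma integrable_bracket (n : ℕ) :
    Integrable (fun t : Rn n => (1 + ‖t‖) ^ (-((n + 1 : ℕ) : ℝ))) :=
  integrable_one_add_norm (by simp)

/-- The inclusion `𝒦₁(ℝⁿ) ↪ 𝒟_{L¹_ω}(ℝⁿ)`. -/
def inclusionLM : K1 n →ₗ[ℂ] DL1 ω where
  toFun φ := ⟨φ, φ.smooth, fun m => by
    obtain ⟨N, B, -, h⟩ := ω.dominated
    refine ((integrable_bracket n).const_mul (B * K1.nuAux n N m φ)).mono' ?_
      (Eventually.of_forall fun t => ?_)
    · exact ((φ.smooth.continuous_iteratedFDeriv (m := m)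
        (mod_cast le_top)).norm.measurable.mul ω.measurable').aestronglyMeasurable
    · rw [Real.norm_of_nonneg (mul_nonneg (norm_nonneg _) (ω.pos' t).le)]
      exact h φ N m le_rfl t⟩
  map_add' φ ψ := rfl
  map_smul' c φ := rfl

/-- The continuous inclusion `𝒦₁(ℝⁿ) ↪ 𝒟_{L¹_ω}(ℝⁿ)`. -/
def inclusion : K1 n →L[ℂ] DL1 ω where
  toLinearMap := ω.inclusionLM
  cont := by
    obtain ⟨N, B, hB, h⟩ := ω.dominated
    refine WithSeminorms.continuous_of_isBounded (K1.withSeminorms n) (DL1.withSeminorms ω)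
      ω.inclusionLM fun k => ?_
    have hJ : 0 ≤ ∫ t : Rn n, (1 + ‖t‖) ^ (-((n + 1 : ℕ) : ℝ)) :=
      integral_nonneg fun t => by positivity
    refine ⟨{N + k}, ⟨B * ∫ t : Rn n, (1 + ‖t‖) ^ (-((n + 1 : ℕ) : ℝ)), mul_nonneg hB hJ⟩, ?_⟩
    intro φ
    rw [Finset.sup_singleton]
    change DL1.normFamily ω k _ ≤
      (B * ∫ t : Rn n, (1 + ‖t‖) ^ (-((n + 1 : ℕ) : ℝ))) * K1.nu n (N + k) φ
    refine Seminorm.finset_sup_apply_le (mul_nonneg (mul_nonneg hB hJ) (apply_nonneg _ _))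
      fun m hm => ?_
    have hm' : m ≤ N + k := by
      have := Finset.mem_range.1 hm
      omega
    refine le_trans ?_ (mul_le_mul_of_nonneg_left (K1.nuAux_le_nu hm' φ) (mul_nonneg hB hJ))
    rw [mul_right_comm, ← integral_const_mul]
    refine integral_mono_of_nonneg
      (Eventually.of_forall fun t => mul_nonneg (norm_nonneg _) (ω.pos' t).le)
      ((integrable_bracket n).const_mul _) (Eventually.of_forall fun t => ?_)
    exact h φ (N + k) m (Nat.le_add_right _ _) t

/-- A continuous compactly supported function is dominated by a multiple of `ω`. -/
lemma exists_bound {φ : Rn n → ℂ} (hφ : Continuous φ) (hc : HasCompactSupport φ) :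
    ∃ C : ℝ≥0, ∀ t, ‖φ t‖ ≤ C * ω t := by
  obtain ⟨A, hA, a, ha, h⟩ := ω.moderate'
  have hcont : Continuous fun t : Rn n => Real.exp (a * ‖t‖) • φ t := by fun_prop
  obtain ⟨M, hM⟩ := hcont.bounded_above_of_compact_support
    (hc.smul_left (f := fun t : Rn n => Real.exp (a * ‖t‖)))
  have h0 := ω.pos' 0
  have hM0 : 0 ≤ M := (norm_nonneg _).trans (hM 0)
  refine ⟨⟨M * A / ω 0, by positivity⟩, fun t => ?_⟩
  have h1 : ω 0 ≤ A * ω t * Real.exp (a * ‖t‖) := by simpa using h (-t) t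
  have h2 : Real.exp (a * ‖t‖) * ‖φ t‖ ≤ M := by
    have := hM t
    rwa [norm_smul, Real.norm_of_nonneg (Real.exp_pos _).le] at this
  change ‖φ t‖ ≤ M * A / ω 0 * ω t
  rw [div_mul_eq_mul_div, le_div_iff₀ h0]
  have hAω : 0 ≤ A * ω t := mul_nonneg hA.le (ω.pos' t).le
  calc ‖φ t‖ * ω 0 ≤ ‖φ t‖ * (A * ω t * Real.exp (a * ‖t‖)) := by gcongr
    _ = A * ω t * (Real.exp (a * ‖t‖) * ‖φ t‖) := by ring
    _ ≤ A * ω t * M := by gcongr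
    _ = M * A * ω t := by ring

lemma integrable_testFunction_mul (φ : 𝓓((⊤ : TopologicalSpace.Opens (Rn n)), ℂ)) (θ : DL1 ω) :
    Integrable (fun t => φ t * θ t) :=
  (φ.continuous.mul θ.smooth.continuous).integrable_of_hasCompactSupport
    φ.hasCompactSupport.mul_right

/-- The space `ℬ'_ω(ℝⁿ)`: the strong dual of `𝒟_{L¹_ω}(ℝⁿ)`. -/
abbrev BDual : Type := DL1 ω →L[ℂ] ℂ

/-- The linear functional `θ ↦ ∫ φ θ` defined by a test function `φ ∈ 𝒟(ℝⁿ)`. -/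
def ofTestFunctionLM (φ : 𝓓((⊤ : TopologicalSpace.Opens (Rn n)), ℂ)) : DL1 ω →ₗ[ℂ] ℂ where
  toFun θ := ∫ t, φ t * θ t
  map_add' θ₁ θ₂ := by
    rw [← integral_add (ω.integrable_testFunction_mul φ θ₁) (ω.integrable_testFunction_mul φ θ₂)]
    simp only [DL1.coe_add, Pi.add_apply, mul_add]
  map_smul' c θ := by
    rw [RingHom.id_apply, smul_eq_mul, ← integral_const_mul]
    simp only [DL1.coe_smul, Pi.smul_apply, smul_eq_mul, mul_left_comm]

/-- The element of `ℬ'_ω(ℝⁿ)` defined by a test function `φ ∈ 𝒟(ℝⁿ)`: `θ ↦ ∫ φ θ`. -/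
def ofTestFunction (φ : 𝓓((⊤ : TopologicalSpace.Opens (Rn n)), ℂ)) : ω.BDual where
  toLinearMap := ω.ofTestFunctionLM φ
  cont := by
    obtain ⟨C, hC⟩ := ω.exists_bound φ.continuous φ.hasCompactSupport
    refine WithSeminorms.continuous_normedSpace_rng ℂ (DL1.withSeminorms ω)
      (ω.ofTestFunctionLM φ) ⟨{0}, C, ?_⟩
    intro θ
    rw [Finset.sup_singleton]
    change ‖∫ t, φ t * θ t‖ ≤ C * DL1.normFamily ω 0 θ
    have h0 : DL1.normFamily ω 0 θ = ∫ t : Rn n, ‖iteratedFDeriv ℝ 0 θ t‖ * ω t := by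
      change (Finset.range 1).sup (DL1.normAux ω) θ = _
      rw [Finset.range_one, Finset.sup_singleton]
      rfl
    rw [h0, ← integral_const_mul]
    refine norm_integral_le_of_norm_le ((θ.integrable 0).const_mul _)
      (Eventually.of_forall fun t => ?_)
    rw [norm_mul, norm_iteratedFDeriv_zero]
    calc ‖φ t‖ * ‖θ t‖ ≤ (C * ω t) * ‖θ t‖ := by gcongr; exact hC t
      _ = _ := by ring

/-- The canonical map `ℬ'_ω(ℝⁿ) → 𝒦₁'(ℝⁿ)`, restriction of functionals to `𝒦₁(ℝⁿ)`
(injective, because `𝒦₁(ℝⁿ)` is dense in `𝒟_{L¹_ω}(ℝⁿ)`). -/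
def restrict (g : ω.BDual) : K1Dual n := g.comp ω.inclusion

/-- `ℬ'_ω(ℝⁿ)` as a subset of `𝒦₁'(ℝⁿ)`. -/
def boundedDistributions : Set (K1Dual n) := Set.range ω.restrict

/-- `ℬ̇'_ω(ℝⁿ)` as a subset of `𝒦₁'(ℝⁿ)`: the closure of `𝒟(ℝⁿ)` in the strong dual
`ℬ'_ω(ℝⁿ)`. -/
def dotBoundedDistributions : Set (K1Dual n) :=
  ω.restrict '' closure (Set.range ω.ofTestFunction)

end ExpModerateWeight

end

/-!
The theorem is a duality statement for expansions into the time-frequency shifts `M_ξ T_x γ`.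

*Reconstruction.* Choose a compactly supported `γ ∈ 𝒦₁` with `κ = ∫ γ conj ψ ≠ 0`, and put
`coeff γ θ (x, ξ) = ∫ θ(t) M_ξ T_x γ(t) dt`, the inverse Fourier transform of `θ γ(· - x)` at `ξ`.
Fourier inversion in `ξ`, followed by integration in `x`, gives
`κ φ = ∫ coeff γ φ p • conj (M_ξ T_x ψ) dp`, with `p = (x, ξ)`, at every point.  The integral
converges absolutely in every norm of `𝒦₁`, so that every `f ∈ 𝒦₁'` can be applied under the
integral sign (`K1.map_integral`), and `κ f(φ) = ∫ V_ψ f(p) coeff γ φ p dp`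
(`K1.integral_stft_mul_coeff`).  To apply `f` under the integral sign, `f` is extended by the
Hahn-Banach theorem from a norm `ν_k` to a Banach space of families of bounded continuous functions,
where Bochner integrals are computed pointwise.

*The estimate.* For `θ ∈ 𝒟_{L¹_ω}` the integral `∫ ω(x) (1 + |ξ|)^s |coeff γ θ (x, ξ)| dx dξ` is
bounded by a norm of `θ` (`K1.exists_coeff_le`, `K1.exists_integral_mul_coeff_le`): integration by
parts in `t` buys decay in `ξ` with derivatives of `θ`, and moderateness of `ω` turns the integral
in `x` into a convolution of integrable functions.  Hence a function `V` on phase space with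
`|V(x, ξ)| ≤ M ω(x) (1 + |ξ|)^s` defines a functional `θ ↦ ∫ V coeff γ θ` in `ℬ'_ω`, bounded by `M`
times a fixed norm.  With `V = κ⁻¹ V_ψ f` this shows that growth bounds on `V_ψ f` imply `f ∈ ℬ'_ω`.
If moreover `V` is small at infinity, then cutting it off to balls changes the functional by little,
and the functionals of the cut-off functions are given by test functions
(`K1.exists_testFunction_eq_synthesis`), because `γ` has compact support; hence `f ∈ ℬ̇'_ω`.

*The remaining implications.* The norms of `T_h φ` in `𝒟_{L¹_ω}` are `O(ω(h))`, so the set of all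
`T_{-h} f / ω(h)` is bounded for `f ∈ ℬ'_ω`; for `f ∈ ℬ̇'_ω` they vanish at infinity, by
approximation of `f` by test functions on a bounded set.  To pass to `V_ψ f`, note that a strongly
bounded subset of the dual is equicontinuous (`WithSeminorms.exists_norm_le_of_isVonNBounded`), and
that `|V_ψ f(x, ξ)|` is the modulus of `T_{-x} f` at `M_{-ξ} conj ψ`, whose norms grow polynomially
in `ξ`.  For the limit, one more power of `1 + |ξ|` handles large `ξ`, and for `ξ` in a ball these
functions form a bounded set.
-/

noncomputable section

/-! ### Time-frequency shifts on `𝒦₁` -/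

namespace K1

variable {n : ℕ}

lemma nu_le {k : ℕ} {φ : K1 n} {C : ℝ} (hC : 0 ≤ C)
    (h : ∀ m ≤ k, ∀ t, Real.exp (k * ‖t‖) * ‖iteratedFDeriv ℝ m φ t‖ ≤ C) : nu n k φ ≤ C :=
  Seminorm.finset_sup_apply_le hC fun m hm =>
    ciSup_le fun t => h m (Nat.le_of_lt_succ (Finset.mem_range.1 hm)) t

lemma le_nu {k m : ℕ} (h : m ≤ k) (φ : K1 n) (t : Rn n) :
    Real.exp (k * ‖t‖) * ‖iteratedFDeriv ℝ m φ t‖ ≤ nu n k φ :=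
  (le_nuAux φ k m t).trans (nuAux_le_nu h φ)

lemma nu_mono {k l : ℕ} (h : k ≤ l) (φ : K1 n) : nu n k φ ≤ nu n l φ :=
  nu_le (apply_nonneg _ _) fun m hm t => by
    refine le_trans ?_ (le_nu (hm.trans h) φ t)
    gcongr

lemma norm_iteratedFDeriv_le {k m : ℕ} (h : m ≤ k) (φ : K1 n) (t : Rn n) :
    ‖iteratedFDeriv ℝ m φ t‖ ≤ nu n k φ * Real.exp (-(k * ‖t‖)) := by
  rw [Real.exp_neg, ← div_eq_mul_inv, le_div_iff₀ (Real.exp_pos _), mul_comm]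
  exact le_nu h φ t

lemma norm_apply_le (k : ℕ) (φ : K1 n) (t : Rn n) :
    ‖φ t‖ ≤ nu n k φ * Real.exp (-(k * ‖t‖)) := by
  simpa using norm_iteratedFDeriv_le (Nat.zero_le k) φ t

lemma translate_apply (h : Rn n) (φ : K1 n) (t : Rn n) : translate h φ t = φ (t - h) := rfl

lemma modulate_apply (ξ : Rn n) (φ : K1 n) (t : Rn n) :
    modulate ξ φ t = character ξ t * φ t := rfl

lemma conj_apply (φ : K1 n) (t : Rn n) : conj φ t = (starRingEnd ℂ) (φ t) := rfl

lemma sub_apply (φ χ : K1 n) (t : Rn n) : (φ - χ) t = φ t - χ t := rfl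

lemma add_apply (φ χ : K1 n) (t : Rn n) : (φ + χ) t = φ t + χ t := rfl

lemma smul_apply (c : ℂ) (φ : K1 n) (t : Rn n) : (c • φ) t = c * φ t := rfl

lemma norm_character (ξ t : Rn n) : ‖character ξ t‖ = 1 := by
  rw [character, show (2 * Real.pi * I * ((inner ℝ ξ t : ℝ) : ℂ)) =
    ((2 * Real.pi * inner ℝ ξ t : ℝ) : ℂ) * I by push_cast; ring]
  exact Complex.norm_exp_ofReal_mul_I _

lemma character_add (ξ η t : Rn n) : character (ξ + η) t = character ξ t * character η t := by
  simp only [character, ← Complex.exp_add, inner_add_left]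
  push_cast
  ring_nf

lemma conj_character (ξ t : Rn n) : (starRingEnd ℂ) (character ξ t) = character (-ξ) t := by
  simp only [character, ← Complex.exp_conj, inner_neg_left, map_mul, conj_I, conj_ofReal, map_ofNat]
  push_cast
  ring_nf

lemma norm_iteratedFDeriv_character_le (ξ : Rn n) (m : ℕ) (t : Rn n) :
    ‖iteratedFDeriv ℝ m (character ξ) t‖ ≤ (2 * Real.pi * ‖ξ‖) ^ m := by
  have hg : ContDiff ℝ (⊤ : ℕ∞) (fun s : ℝ => cexp (2 * Real.pi * I * s)) :=
    Complex.contDiff_exp.comp (contDiff_const.mul Complex.ofRealCLM.contDiff)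
  have hd : ∀ j : ℕ, iteratedDeriv j (fun s : ℝ => cexp (2 * Real.pi * I * s)) =
      fun s : ℝ => (2 * Real.pi * I) ^ j * cexp (2 * Real.pi * I * s) := by
    intro j
    induction j with
    | zero => simp
    | succ j ih =>
      rw [iteratedDeriv_succ, ih]
      funext s
      have h : HasDerivAt (fun s : ℝ => cexp (2 * Real.pi * I * s))
          (cexp (2 * Real.pi * I * s) * (2 * Real.pi * I)) s := by
        have h' := ((hasDerivAt_id s).ofReal_comp.const_mul (2 * Real.pi * I : ℂ)).cexp
        simpa using h'
      rw [(h.const_mul _).deriv]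
      ring
  have hc : character ξ = (fun s : ℝ => cexp (2 * Real.pi * I * s)) ∘ (innerSL ℝ ξ) := rfl
  have h1 := norm_character ξ t
  rw [hc] at h1 ⊢
  rw [(innerSL ℝ ξ).iteratedFDeriv_comp_right hg t (mod_cast le_top)]
  refine (ContinuousMultilinearMap.norm_compContinuousLinearMap_le _ _).trans ?_
  simp only [Function.comp_apply] at h1
  rw [norm_iteratedFDeriv_eq_norm_iteratedDeriv, hd, norm_mul, h1, mul_one]
  simp [abs_of_pos Real.pi_pos, mul_pow]

/-- Multiplication by a smooth function of exponential growth in the norms of `𝒦₁`. -/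
lemma exp_mul_norm_iteratedFDeriv_mul_le {g : Rn n → ℂ} (hg : ContDiff ℝ (⊤ : ℕ∞) g) (φ : K1 n)
    {k l : ℕ} {G : ℝ} (hG : ∀ i ≤ k, ∀ t, ‖iteratedFDeriv ℝ i g t‖ ≤ G * Real.exp (l * ‖t‖))
    {m : ℕ} (hm : m ≤ k) (t : Rn n) :
    Real.exp (k * ‖t‖) * ‖iteratedFDeriv ℝ m (fun t => g t * φ t) t‖ ≤
      2 ^ k * G * nu n (k + l) φ := by
  have hG0 : 0 ≤ G := by
    have := (norm_nonneg _).trans (hG 0 (Nat.zero_le _) t)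
    exact nonneg_of_mul_nonneg_left this (Real.exp_pos _)
  have h := norm_iteratedFDeriv_mul_le (𝕜 := ℝ) hg φ.smooth t (n := m) (mod_cast le_top)
  refine (mul_le_mul_of_nonneg_left h (Real.exp_pos _).le).trans ?_
  rw [Finset.mul_sum]
  calc ∑ i ∈ Finset.range (m + 1), Real.exp (k * ‖t‖) *
        ((m.choose i : ℝ) * ‖iteratedFDeriv ℝ i g t‖ * ‖iteratedFDeriv ℝ (m - i) φ t‖)
      ≤ ∑ i ∈ Finset.range (m + 1), (m.choose i : ℝ) * (G * nu n (k + l) φ) := by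
        refine Finset.sum_le_sum fun i hi => ?_
        have hi' : i ≤ k := (Nat.le_of_lt_succ (Finset.mem_range.1 hi)).trans hm
        have h1 := le_nu (k := k + l) (m := m - i) (by omega) φ t
        push_cast at h1
        rw [add_mul, Real.exp_add] at h1
        calc _ = (m.choose i : ℝ) * (‖iteratedFDeriv ℝ i g t‖ *
              (Real.exp (k * ‖t‖) * ‖iteratedFDeriv ℝ (m - i) φ t‖)) := by ring
          _ ≤ (m.choose i : ℝ) * ((G * Real.exp (l * ‖t‖)) *
              (Real.exp (k * ‖t‖) * ‖iteratedFDeriv ℝ (m - i) φ t‖)) := by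
            gcongr
            exact hG i hi' t
          _ = (m.choose i : ℝ) * (G * (Real.exp (k * ‖t‖) * Real.exp (l * ‖t‖) *
              ‖iteratedFDeriv ℝ (m - i) φ t‖)) := by ring
          _ ≤ _ := by gcongr
    _ = 2 ^ m * (G * nu n (k + l) φ) := by
        rw [← Finset.sum_mul]
        congr 1
        exact_mod_cast Nat.sum_range_choose m
    _ ≤ 2 ^ k * (G * nu n (k + l) φ) := by
        have := apply_nonneg (nu n (k + l)) φ
        gcongr
        norm_num
    _ = _ := by ring

lemma nu_translate_le (k : ℕ) (h : Rn n) (φ : K1 n) :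
    nu n k (translate h φ) ≤ Real.exp (k * ‖h‖) * nu n k φ := by
  refine nu_le (mul_nonneg (Real.exp_pos _).le (apply_nonneg _ _)) fun m hm t => ?_
  change Real.exp (k * ‖t‖) * ‖iteratedFDeriv ℝ m (fun t => φ (t - h)) t‖ ≤ _
  rw [iteratedFDeriv_comp_sub]
  refine le_trans ?_ (mul_le_mul_of_nonneg_left (le_nu hm φ (t - h)) (Real.exp_pos _).le)
  rw [← mul_assoc, ← Real.exp_add, ← mul_add]
  gcongr
  calc ‖t‖ = ‖h + (t - h)‖ := by congr 1; abel
    _ ≤ _ := norm_add_le _ _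

lemma nu_modulate_le (k : ℕ) (ξ : Rn n) (φ : K1 n) :
    nu n k (modulate ξ φ) ≤ (4 * Real.pi * (1 + ‖ξ‖)) ^ k * nu n k φ := by
  have hpi := Real.pi_gt_three
  refine nu_le (mul_nonneg (by positivity) (apply_nonneg _ _)) fun m hm t => ?_
  refine (exp_mul_norm_iteratedFDeriv_mul_le (character_smooth ξ) φ (k := k) (l := 0)
    (G := (2 * Real.pi * (1 + ‖ξ‖)) ^ k) (fun i hi t => ?_) hm t).trans (le_of_eq ?_)
  · simp only [Nat.cast_zero, zero_mul, Real.exp_zero, mul_one]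
    calc _ ≤ (2 * Real.pi * ‖ξ‖) ^ i := norm_iteratedFDeriv_character_le ξ i t
      _ ≤ (2 * Real.pi * (1 + ‖ξ‖)) ^ i := by gcongr; linarith
      _ ≤ _ := by
        gcongr
        nlinarith [norm_nonneg ξ]
  · rw [Nat.add_zero, ← mul_pow]
    ring_nf

lemma nu_conj (k : ℕ) (φ : K1 n) : nu n k (conj φ) = nu n k φ := by
  have key : ∀ m t, ‖iteratedFDeriv ℝ m (conj φ) t‖ = ‖iteratedFDeriv ℝ m φ t‖ := fun m t =>
    Complex.conjLIE.norm_iteratedFDeriv_comp_left (𝕜 := ℝ) φ t m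
  refine le_antisymm (nu_le (apply_nonneg _ _) fun m hm t => ?_)
    (nu_le (apply_nonneg _ _) fun m hm t => ?_)
  · rw [key]; exact le_nu hm φ t
  · rw [← key]; exact le_nu hm (conj φ) t

lemma nu_translate_sub_le (k : ℕ) (h : Rn n) (φ : K1 n) :
    nu n k (translate h φ - φ) ≤ ‖h‖ * Real.exp ((k + 1 : ℕ) * ‖h‖) * nu n (k + 1) φ := by
  refine nu_le (mul_nonneg (by positivity) (apply_nonneg _ _)) fun m hm t => ?_
  have hs : iteratedFDeriv ℝ m (⇑(translate h φ - φ)) t =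
      iteratedFDeriv ℝ m φ (t - h) - iteratedFDeriv ℝ m φ t := by
    have : ⇑(translate h φ - φ) = ⇑(translate h φ) + (-1 : ℂ) • ⇑φ := by
      funext s
      rw [sub_apply]
      simp [sub_eq_add_neg]
    rw [this, iteratedFDeriv_add_eq (g := (-1 : ℂ) • ⇑φ) (translate h φ).smooth
      (φ.smooth.const_smul (-1 : ℂ)),
      iteratedFDeriv_smul_eq φ.smooth]
    change iteratedFDeriv ℝ m (fun t => φ (t - h)) t + _ = _
    rw [iteratedFDeriv_comp_sub]
    simp [sub_eq_add_neg]
  have hd : ∀ s ∈ segment ℝ t (t - h), ‖fderiv ℝ (iteratedFDeriv ℝ m φ) s‖ ≤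
      nu n (k + 1) φ * (Real.exp ((k + 1 : ℕ) * ‖h‖) * Real.exp (-((k + 1 : ℕ) * ‖t‖))) := by
    intro s hs
    rw [norm_fderiv_iteratedFDeriv]
    refine (norm_iteratedFDeriv_le (k := k + 1) (by omega) φ s).trans ?_
    refine mul_le_mul_of_nonneg_left ?_ (apply_nonneg _ _)
    rw [← Real.exp_add]
    have h1 : ‖s - t‖ ≤ ‖h‖ := by
      obtain ⟨a, b, ha, hb, hab, rfl⟩ := hs
      have : a • t + b • (t - h) - t = (-b) • h := by
        rw [smul_sub, show a • t + (b • t - b • h) = (a + b) • t - b • h by rw [add_smul]; abel,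
          hab]
        simp
      rw [this, norm_smul, norm_neg, Real.norm_of_nonneg hb]
      nlinarith [norm_nonneg h]
    have h2 : ‖t‖ ≤ ‖s‖ + ‖h‖ := by
      have := norm_sub_norm_le t s
      rw [norm_sub_rev] at this
      linarith
    have : ((k + 1 : ℕ) : ℝ) * ‖t‖ ≤ (k + 1 : ℕ) * (‖s‖ + ‖h‖) := by gcongr
    gcongr
    linarith
  have hmv := Convex.norm_image_sub_le_of_norm_fderiv_le (𝕜 := ℝ)
    (fun s _ => (φ.smooth.differentiable_iteratedFDeriv (m := m)
      (mod_cast WithTop.coe_lt_top _)).differentiableAt) hd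
    (convex_segment t (t - h)) (left_mem_segment ℝ _ _) (right_mem_segment ℝ _ _)
  rw [hs]
  have h3 : Real.exp (k * ‖t‖) * Real.exp (-((k + 1 : ℕ) * ‖t‖)) ≤ 1 := by
    rw [← Real.exp_add, Real.exp_le_one_iff]
    push_cast
    nlinarith [norm_nonneg t]
  have h0 := apply_nonneg (nu n (k + 1)) φ
  have h4 : ‖t - h - t‖ = ‖h‖ := by rw [show t - h - t = -h by abel, norm_neg]
  rw [h4] at hmv
  calc _ ≤ Real.exp (k * ‖t‖) * (nu n (k + 1) φ *
        (Real.exp ((k + 1 : ℕ) * ‖h‖) * Real.exp (-((k + 1 : ℕ) * ‖t‖))) * ‖h‖) := by gcongr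
    _ = (Real.exp (k * ‖t‖) * Real.exp (-((k + 1 : ℕ) * ‖t‖))) *
        (‖h‖ * Real.exp ((k + 1 : ℕ) * ‖h‖) * nu n (k + 1) φ) := by ring
    _ ≤ 1 * (‖h‖ * Real.exp ((k + 1 : ℕ) * ‖h‖) * nu n (k + 1) φ) := by gcongr
    _ = _ := one_mul _

lemma nu_modulate_sub_le (k : ℕ) (ξ : Rn n) (φ : K1 n) :
    nu n k (modulate ξ φ - φ) ≤
      2 ^ k * (2 * Real.pi * ‖ξ‖ * (2 * Real.pi * (1 + ‖ξ‖)) ^ k) * nu n (k + 1) φ := by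
  have hpi := Real.pi_gt_three
  refine nu_le (mul_nonneg (by positivity) (apply_nonneg _ _)) fun m hm t => ?_
  have he : ⇑(modulate ξ φ - φ) = fun t => (character ξ t - 1) * φ t := by
    funext s
    rw [sub_apply, modulate_apply]
    ring
  rw [he]
  have hB : 1 ≤ 2 * Real.pi * (1 + ‖ξ‖) := by nlinarith [norm_nonneg ξ]
  refine exp_mul_norm_iteratedFDeriv_mul_le ((character_smooth ξ).sub contDiff_const) φ
    (k := k) (l := 1) (fun i hi t => ?_) hm t
  have hexp : 1 ≤ Real.exp ((1 : ℕ) * ‖t‖) := Real.one_le_exp (by positivity)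
  rcases Nat.eq_zero_or_pos i with rfl | hi0
  · rw [norm_iteratedFDeriv_zero]
    have h1 : ‖character ξ t - 1‖ ≤ 2 * Real.pi * (‖ξ‖ * ‖t‖) := by
      rw [character, show (2 * Real.pi * I * ((inner ℝ ξ t : ℝ) : ℂ)) =
        I * ((2 * Real.pi * inner ℝ ξ t : ℝ) : ℂ) by push_cast; ring]
      refine (Real.norm_exp_I_mul_ofReal_sub_one_le).trans ?_
      rw [norm_mul, Real.norm_of_nonneg (by positivity)]
      gcongr
      exact norm_inner_le_norm ξ t
    have h2 : ‖t‖ ≤ Real.exp ((1 : ℕ) * ‖t‖) := by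
      have := Real.add_one_le_exp ‖t‖
      simp only [Nat.cast_one, one_mul]
      linarith
    have h3 : (1 : ℝ) ≤ (2 * Real.pi * (1 + ‖ξ‖)) ^ k := one_le_pow₀ hB
    calc _ ≤ 2 * Real.pi * (‖ξ‖ * ‖t‖) := h1
      _ ≤ 2 * Real.pi * ‖ξ‖ * 1 * Real.exp ((1 : ℕ) * ‖t‖) := by
        rw [mul_one, mul_assoc _ ‖ξ‖]
        gcongr
      _ ≤ _ := by gcongr
  · have h0 : iteratedFDeriv ℝ i (fun t => character ξ t - 1) t =
        iteratedFDeriv ℝ i (character ξ) t := by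
      have h := iteratedFDeriv_add_eq (character_smooth ξ)
        (contDiff_const (c := (-1 : ℂ))) i t
      rw [iteratedFDeriv_const_of_ne hi0.ne'] at h
      simpa [Pi.add_def, sub_eq_add_neg] using h
    rw [h0]
    obtain ⟨j, rfl⟩ : ∃ j, i = j + 1 := ⟨i - 1, by omega⟩
    calc _ ≤ (2 * Real.pi * ‖ξ‖) ^ (j + 1) := norm_iteratedFDeriv_character_le ξ _ t
      _ = 2 * Real.pi * ‖ξ‖ * (2 * Real.pi * ‖ξ‖) ^ j * 1 := by ring
      _ ≤ 2 * Real.pi * ‖ξ‖ * (2 * Real.pi * (1 + ‖ξ‖)) ^ k * Real.exp ((1 : ℕ) * ‖t‖) := by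
        gcongr
        calc (2 * Real.pi * ‖ξ‖) ^ j ≤ (2 * Real.pi * (1 + ‖ξ‖)) ^ j := by gcongr; linarith
          _ ≤ _ := pow_le_pow_right₀ hB (by omega)

/-- The time-frequency shift `M_ξ T_x φ` with parameter `p = (x, ξ)`. -/
def tfShift (φ : K1 n) (p : Rn n × Rn n) : K1 n := modulate p.2 (translate p.1 φ)

lemma tfShift_apply (φ : K1 n) (p : Rn n × Rn n) (t : Rn n) :
    tfShift φ p t = character p.2 t * φ (t - p.1) := rfl

lemma conj_tfShift (φ : K1 n) (x ξ : Rn n) :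
    conj (tfShift φ (x, ξ)) = tfShift (conj φ) (x, -ξ) :=
  DFunLike.ext _ _ fun t => by
    rw [conj_apply, tfShift_apply, tfShift_apply, map_mul, conj_character, conj_apply]

lemma nu_tfShift_le (k : ℕ) (φ : K1 n) (p : Rn n × Rn n) :
    nu n k (tfShift φ p) ≤
      (4 * Real.pi * (1 + ‖p.2‖)) ^ k * (Real.exp (k * ‖p.1‖) * nu n k φ) := by
  have hpi := Real.pi_pos
  exact (nu_modulate_le k p.2 _).trans
    (mul_le_mul_of_nonneg_left (nu_translate_le k p.1 φ) (by positivity))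

/-- Time-frequency shifts act strongly continuously on `𝒦₁`. -/
lemma continuous_tfShift (φ : K1 n) : Continuous (tfShift φ) := by
  have hpi := Real.pi_pos
  rw [continuous_iff_continuousAt]
  rintro ⟨x₀, ξ₀⟩
  refine ((withSeminorms n).tendsto_nhds _ _).2 fun k ε hε => ?_
  set χ := translate x₀ φ
  let B : Rn n × Rn n → ℝ := fun p =>
    (4 * Real.pi * (1 + ‖p.2‖)) ^ k * (Real.exp (k * ‖x₀‖) *
      (‖p.1 - x₀‖ * Real.exp ((k + 1 : ℕ) * ‖p.1 - x₀‖) * nu n (k + 1) φ)) +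
    (4 * Real.pi * (1 + ‖ξ₀‖)) ^ k * (2 ^ k * (2 * Real.pi * ‖p.2 - ξ₀‖ *
      (2 * Real.pi * (1 + ‖p.2 - ξ₀‖)) ^ k) * nu n (k + 1) χ)
  have hB : Continuous B := by fun_prop
  have hB0 : B (x₀, ξ₀) = 0 := by simp [B]
  have hev : ∀ᶠ p in 𝓝 (x₀, ξ₀), B p < ε :=
    hB.continuousAt.eventually (gt_mem_nhds (by rw [hB0]; exact hε))
  refine hev.mono fun p hp => lt_of_le_of_lt ?_ hp
  have hsplit : tfShift φ p - tfShift φ (x₀, ξ₀) =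
      modulate p.2 (translate x₀ (translate (p.1 - x₀) φ - φ)) +
        modulate ξ₀ (modulate (p.2 - ξ₀) χ - χ) := by
    refine DFunLike.ext _ _ fun t => ?_
    have hc : character p.2 t = character ξ₀ t * character (p.2 - ξ₀) t := by
      rw [← character_add]
      congr 1
      abel
    simp only [add_apply, sub_apply, tfShift_apply, modulate_apply, translate_apply, χ]
    rw [show t - x₀ - (p.1 - x₀) = t - p.1 by abel, hc]
    ring
  rw [hsplit]
  refine (map_add_le_add _ _ _).trans (add_le_add ?_ ?_)
  · refine (nu_modulate_le k _ _).trans (mul_le_mul_of_nonneg_left ?_ (by positivity))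
    refine (nu_translate_le k _ _).trans (mul_le_mul_of_nonneg_left ?_ (by positivity))
    exact nu_translate_sub_le k _ φ
  · exact (nu_modulate_le k _ _).trans
      (mul_le_mul_of_nonneg_left (nu_modulate_sub_le k _ χ) (by positivity))

end K1

/-- A functional which is continuous for an increasing sequence of seminorms is bounded by one of
them. -/
lemma WithSeminorms.exists_norm_le_of_mono {E : Type*} [AddCommGroup E] [Module ℂ E]
    [TopologicalSpace E] {p : SeminormFamily ℂ E ℕ} (hp : WithSeminorms p) (hm : Monotone p)
    (f : E →L[ℂ] ℂ) : ∃ (k : ℕ) (C : ℝ), 0 ≤ C ∧ ∀ x, ‖f x‖ ≤ C * p k x := by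
  obtain ⟨s, C, -, h⟩ := Seminorm.bound_of_continuous hp
    ((normSeminorm ℂ ℂ).comp f.toLinearMap) (continuous_norm.comp f.continuous)
  refine ⟨s.sup id, C, C.2, fun x => (h x).trans ?_⟩
  refine mul_le_mul_of_nonneg_left ?_ C.2
  exact Seminorm.finset_sup_apply_le (apply_nonneg _ _) fun i hi =>
    hm (Finset.le_sup (f := id) hi) x

lemma K1Dual.exists_bound {n : ℕ} (f : K1Dual n) :
    ∃ (k : ℕ) (C : ℝ), 0 ≤ C ∧ ∀ φ, ‖f φ‖ ≤ C * K1.nu n k φ :=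
  (K1.withSeminorms n).exists_norm_le_of_mono (fun _ _ h φ => K1.nu_mono h φ) f

/-! ### Integrals with values in `𝒦₁` -/

/-- Differentiation under the integral sign, for derivatives that are images of `W`-valued
functions under a linear isometry `L` from `W` to the linear maps. -/
lemma hasFDerivAt_integral_of_linearIsometry {P H F W : Type*} [MeasurableSpace P] {μ : Measure P}
    [NormedAddCommGroup H] [NormedSpace ℝ H] [NormedAddCommGroup F] [NormedSpace ℝ F]
    [NormedAddCommGroup W] [NormedSpace ℝ W] [CompleteSpace W] [CompleteSpace F]
    (L : W →ₗᵢ[ℝ] (H →L[ℝ] F)) {G : P → H → F} {M : P → H → W} {B : P → ℝ} {t : H}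
    (hG : ∀ s, Integrable (fun p => G p s) μ) (hM : Integrable (fun p => M p t) μ)
    (hB : Integrable B μ) (hMB : ∀ p s, ‖M p s‖ ≤ B p)
    (hd : ∀ p s, HasFDerivAt (G p) (L (M p s)) s) :
    HasFDerivAt (fun s => ∫ p, G p s ∂μ) (L (∫ p, M p t ∂μ)) t := by
  have hL : L (∫ p, M p t ∂μ) = ∫ p, L (M p t) ∂μ :=
    (L.toContinuousLinearMap.integral_comp_comm hM).symm
  rw [hL]
  refine hasFDerivAt_integral_of_dominated_of_fderiv_le (𝕜 := ℝ) (s := Set.univ)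
    (F := fun s p => G p s) (F' := fun s p => L (M p s)) Filter.univ_mem
    (Eventually.of_forall fun s => (hG s).1) (hG t) (L.continuous.comp_aestronglyMeasurable hM.1)
    (Eventually.of_forall fun p s _ => ?_) hB (Eventually.of_forall fun p s _ => hd p s)
  rw [L.norm_map]
  exact hMB p s

namespace K1

variable {n : ℕ}

/-- The function `t ↦ e^{k|t|} D^m φ(t)` as a bounded continuous function. -/
def weightedDerivLM (n k m : ℕ) :
    K1 n →ₗ[ℂ] BoundedContinuousFunction (Rn n) (Rn n [×m]→L[ℝ] ℂ) where
  toFun φ := BoundedContinuousFunction.ofNormedAddCommGroup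
    (fun t => Real.exp (k * ‖t‖) • iteratedFDeriv ℝ m φ t)
    ((by fun_prop : Continuous fun t : Rn n => Real.exp (k * ‖t‖)).smul
      (φ.smooth.continuous_iteratedFDeriv (m := m) (mod_cast le_top)))
    (nuAux n k m φ) fun t => by
      rw [norm_smul, Real.norm_of_nonneg (Real.exp_pos _).le]
      exact le_nuAux φ k m t
  map_add' φ χ := by
    ext1 t
    change Real.exp (k * ‖t‖) • iteratedFDeriv ℝ m (⇑φ + ⇑χ) t = _
    rw [iteratedFDeriv_add_eq φ.smooth χ.smooth, smul_add]
    rfl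
  map_smul' c φ := by
    ext1 t
    change Real.exp (k * ‖t‖) • iteratedFDeriv ℝ m (c • ⇑φ) t = _
    rw [iteratedFDeriv_smul_eq φ.smooth, smul_comm]
    rfl

/-- The Banach space of families `(u_m)_{m ≤ k}`, where `u_m` is a bounded continuous function with
values in the `m`-linear maps, with the maximum norm. -/
def JetSpace (n k : ℕ) : Type :=
  (m : Fin (k + 1)) → BoundedContinuousFunction (Rn n) (Rn n [×(m : ℕ)]→L[ℝ] ℂ)

instance (n k : ℕ) : NormedAddCommGroup (JetSpace n k) :=
  @Pi.normedAddCommGroup (Fin (k + 1)) _ _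
    fun _ => BoundedContinuousFunction.instNormedAddCommGroup

instance (n k : ℕ) : NormedSpace ℂ (JetSpace n k) :=
  Pi.normedSpace (𝕜 := ℂ) (ι := Fin (k + 1))
    (E := fun m => BoundedContinuousFunction (Rn n) (Rn n [×(m : ℕ)]→L[ℝ] ℂ))

instance (n k : ℕ) : CompleteSpace (JetSpace n k) :=
  inferInstanceAs (CompleteSpace
    ((m : Fin (k + 1)) → BoundedContinuousFunction (Rn n) (Rn n [×(m : ℕ)]→L[ℝ] ℂ)))

/-- The map `φ ↦ (e^{k|·|} D^m φ)_{m ≤ k}`, which embeds `𝒦₁` with the norm `ν_k` isometrically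
into a Banach space. -/
def jetLM (n k : ℕ) : K1 n →ₗ[ℂ] JetSpace n k where
  toFun φ := fun m => weightedDerivLM n k m φ
  map_add' φ χ := funext fun m => map_add (weightedDerivLM n k m) φ χ
  map_smul' c φ := funext fun m => map_smul (weightedDerivLM n k m) c φ

/-- Evaluation at `t` of the component of order `m`. -/
def JetSpace.eval (n k : ℕ) (m : Fin (k + 1)) (t : Rn n) :
    JetSpace n k →L[ℂ] (Rn n [×(m : ℕ)]→L[ℝ] ℂ) :=
  LinearMap.mkContinuous
    { toFun := fun u => u m t
      map_add' := fun _ _ => rfl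
      map_smul' := fun _ _ => rfl } 1 fun u => by
    rw [one_mul]
    exact ((u m).norm_coe_le_norm t).trans
      (norm_le_pi_norm (G := fun m : Fin (k + 1) =>
        BoundedContinuousFunction (Rn n) (Rn n [×(m : ℕ)]→L[ℝ] ℂ)) u m)

lemma JetSpace.eval_jetLM (k : ℕ) (φ : K1 n) (m : Fin (k + 1)) (t : Rn n) :
    JetSpace.eval n k m t (jetLM n k φ) = Real.exp (k * ‖t‖) • iteratedFDeriv ℝ m φ t := rfl

lemma JetSpace.ext_eval {k : ℕ} {u v : JetSpace n k}
    (h : ∀ m t, JetSpace.eval n k m t u = JetSpace.eval n k m t v) : u = v :=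
  funext fun m => DFunLike.ext _ _ fun t => h m t

lemma norm_jetLM (k : ℕ) (φ : K1 n) : ‖jetLM n k φ‖ = nu n k φ := by
  refine le_antisymm ?_ (nu_le (norm_nonneg _) fun m hm t => ?_)
  · refine (pi_norm_le_iff_of_nonneg (G := fun m : Fin (k + 1) =>
      BoundedContinuousFunction (Rn n) (Rn n [×(m : ℕ)]→L[ℝ] ℂ)) (apply_nonneg _ _)).2 fun m =>
      (BoundedContinuousFunction.norm_le (apply_nonneg _ _)).2 fun t => ?_
    change ‖JetSpace.eval n k m t (jetLM n k φ)‖ ≤ _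
    rw [JetSpace.eval_jetLM, norm_smul, Real.norm_of_nonneg (Real.exp_pos _).le]
    exact le_nu (Nat.le_of_lt_succ m.2) φ t
  · have h2 := (JetSpace.eval n k ⟨m, Nat.lt_succ_of_le hm⟩ t).le_of_opNorm_le
      (LinearMap.mkContinuous_norm_le _ zero_le_one _) (jetLM n k φ)
    rwa [JetSpace.eval_jetLM, norm_smul, Real.norm_of_nonneg (Real.exp_pos _).le, one_mul] at h2

lemma continuous_jetLM (n k : ℕ) : Continuous (jetLM n k) := by
  refine WithSeminorms.continuous_normedSpace_rng (JetSpace n k) (withSeminorms n) (jetLM n k)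
    ⟨{k}, 1, ?_⟩
  intro φ
  rw [Finset.sup_singleton, one_smul]
  exact (norm_jetLM k φ).le

/-- Every continuous functional on `𝒦₁` factors through one of the maps `jetLM`, by the
Hahn-Banach theorem. -/
lemma exists_factor_jetLM (f : K1Dual n) : ∃ (k : ℕ) (F : StrongDual ℂ (JetSpace n k)),
    ∀ φ, F (jetLM n k φ) = f φ := by
  obtain ⟨k, C, hC, hf⟩ := f.exists_bound
  obtain ⟨s, hs⟩ := (jetLM n k).rangeRestrict.exists_rightInverse_of_surjective
    (LinearMap.range_rangeRestrict _)
  have hs' : ∀ y, jetLM n k (s y) = y := fun y =>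
    congrArg Subtype.val (LinearMap.congr_fun hs y)
  let f₀ : LinearMap.range (jetLM n k) →ₗ[ℂ] ℂ := f.toLinearMap ∘ₗ s
  have hb : ∀ y, ‖f₀ y‖ ≤ C * ‖y‖ := fun y => by
    refine (hf (s y)).trans_eq ?_
    rw [← norm_jetLM, hs']
    rfl
  obtain ⟨F, hF, -⟩ := exists_extension_norm_eq _ (f₀.mkContinuous C hb)
  refine ⟨k, F, fun φ => ?_⟩
  have h1 := hF ⟨jetLM n k φ, φ, rfl⟩
  rw [h1]
  change f (s _) = f φ
  rw [← sub_eq_zero, ← map_sub, ← norm_le_zero_iff]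
  refine (hf _).trans_eq ?_
  rw [← norm_jetLM, map_sub, hs', sub_self, norm_zero, mul_zero]

variable {P : Type*} [TopologicalSpace P] {a : P → ℂ} {e : P → K1 n}

lemma continuous_iteratedFDeriv_param (he : Continuous e) (m : ℕ) (t : Rn n) :
    Continuous fun p => iteratedFDeriv ℝ m (e p) t := by
  have h1 : Continuous fun p => JetSpace.eval n m (Fin.last m) t (jetLM n m (e p)) :=
    (JetSpace.eval n m (Fin.last m) t).continuous.comp ((continuous_jetLM n m).comp he)
  have h2 := h1.const_smul (Real.exp (m * ‖t‖))⁻¹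
  simp only [Pi.smul_def, JetSpace.eval_jetLM, smul_smul,
    inv_mul_cancel₀ (Real.exp_pos _).ne', one_smul] at h2
  exact h2

lemma continuous_apply_param (he : Continuous e) (t : Rn n) : Continuous fun p => e p t := by
  have h := (continuousMultilinearCurryFin0 ℝ (Rn n) ℂ).continuous.comp
    (continuous_iteratedFDeriv_param he 0 t)
  refine h.congr fun p => ?_
  simp [iteratedFDeriv_zero_eq_comp]

variable [MeasurableSpace P] [OpensMeasurableSpace P] {μ : Measure P}

lemma integrable_mul_apply (ha : AEStronglyMeasurable a μ) (he : Continuous e)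
    (hi : ∀ k, Integrable (fun p => ‖a p‖ * nu n k (e p)) μ) (t : Rn n) :
    Integrable (fun p => a p * e p t) μ := by
  refine (hi 0).mono' (ha.mul (continuous_apply_param he t).aestronglyMeasurable)
    (Eventually.of_forall fun p => ?_)
  rw [norm_mul]
  refine mul_le_mul_of_nonneg_left ?_ (norm_nonneg _)
  simpa using norm_apply_le 0 (e p) t

variable [SecondCountableTopology P]

lemma integrable_smul_iteratedFDeriv (ha : AEStronglyMeasurable a μ) (he : Continuous e)
    (hi : ∀ k, Integrable (fun p => ‖a p‖ * nu n k (e p)) μ) (m : ℕ) (t : Rn n) :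
    Integrable (fun p => a p • iteratedFDeriv ℝ m (e p) t) μ := by
  refine (hi m).mono'
    (ha.smul (continuous_iteratedFDeriv_param he m t).aestronglyMeasurable)
    (Eventually.of_forall fun p => ?_)
  rw [norm_smul]
  refine mul_le_mul_of_nonneg_left ?_ (norm_nonneg _)
  refine le_trans ?_ (le_nu le_rfl (e p) t)
  exact le_mul_of_one_le_left (norm_nonneg _) (Real.one_le_exp (by positivity))

lemma hasFDerivAt_integral_iteratedFDeriv (ha : AEStronglyMeasurable a μ) (he : Continuous e)
    (hi : ∀ k, Integrable (fun p => ‖a p‖ * nu n k (e p)) μ) (m : ℕ) (t : Rn n) :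
    HasFDerivAt (fun t => ∫ p, a p • iteratedFDeriv ℝ m (e p) t ∂μ)
      (continuousMultilinearCurryLeftEquiv ℝ (fun _ : Fin (m + 1) => Rn n) ℂ
        (∫ p, a p • iteratedFDeriv ℝ (m + 1) (e p) t ∂μ)) t := by
  have hcurry : ∀ p s, a p • fderiv ℝ (iteratedFDeriv ℝ m (e p)) s =
      continuousMultilinearCurryLeftEquiv ℝ (fun _ : Fin (m + 1) => Rn n) ℂ
        (a p • iteratedFDeriv ℝ (m + 1) (e p) s) := fun p s => by
    rw [iteratedFDeriv_succ_eq_comp_left]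
    ext
    simp
  refine hasFDerivAt_integral_of_linearIsometry
    (L := (continuousMultilinearCurryLeftEquiv ℝ
      (fun _ : Fin (m + 1) => Rn n) ℂ).toLinearIsometry)
    (M := fun p s => a p • iteratedFDeriv ℝ (m + 1) (e p) s)
    (integrable_smul_iteratedFDeriv ha he hi m)
    (integrable_smul_iteratedFDeriv ha he hi (m + 1) t) (hi (m + 1)) (fun p s => ?_) fun p s => ?_
  · rw [norm_smul]
    refine mul_le_mul_of_nonneg_left ?_ (norm_nonneg _)
    refine le_trans ?_ (le_nu le_rfl (e p) s)
    exact le_mul_of_one_le_left (norm_nonneg _) (Real.one_le_exp (by positivity))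
  · have h := (((e p).smooth.differentiable_iteratedFDeriv (m := m)
      (mod_cast WithTop.coe_lt_top _)).differentiableAt (x := s)).hasFDerivAt.fun_const_smul (a p)
    rw [hcurry] at h
    exact h

/-- Differentiation under the integral sign, for an integral of elements of `𝒦₁`. -/
lemma iteratedFDeriv_integral (ha : AEStronglyMeasurable a μ) (he : Continuous e)
    (hi : ∀ k, Integrable (fun p => ‖a p‖ * nu n k (e p)) μ) (m : ℕ) (t : Rn n) :
    iteratedFDeriv ℝ m (fun t => ∫ p, a p * e p t ∂μ) t =
      ∫ p, a p • iteratedFDeriv ℝ m (e p) t ∂μ := by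
  induction m generalizing t with
  | zero =>
    ext v
    rw [iteratedFDeriv_zero_apply, ContinuousMultilinearMap.integral_apply
      (integrable_smul_iteratedFDeriv ha he hi 0 t)]
    simp
  | succ m ih =>
    ext v
    rw [iteratedFDeriv_succ_apply_left, funext ih,
      (hasFDerivAt_integral_iteratedFDeriv ha he hi m t).fderiv,
      continuousMultilinearCurryLeftEquiv_apply, Fin.cons_self_tail]

lemma contDiff_integral (ha : AEStronglyMeasurable a μ) (he : Continuous e)
    (hi : ∀ k, Integrable (fun p => ‖a p‖ * nu n k (e p)) μ) :
    ContDiff ℝ (⊤ : ℕ∞) fun t => ∫ p, a p * e p t ∂μ :=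
  contDiff_of_differentiable_iteratedFDeriv fun m _ => by
    rw [funext (iteratedFDeriv_integral ha he hi m)]
    exact fun t => (hasFDerivAt_integral_iteratedFDeriv ha he hi m t).differentiableAt

/-- A continuous functional on `𝒦₁` commutes with integrals of elements of `𝒦₁` that converge
absolutely in every norm `ν_k`. -/
lemma map_integral (f : K1Dual n) (ha : AEStronglyMeasurable a μ) (he : Continuous e)
    (hi : ∀ k, Integrable (fun p => ‖a p‖ * nu n k (e p)) μ) {φ : K1 n}
    (hφ : ∀ t, φ t = ∫ p, a p * e p t ∂μ) : f φ = ∫ p, a p * f (e p) ∂μ := by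
  obtain ⟨k, F, hF⟩ := exists_factor_jetLM f
  have hint : Integrable (fun p => a p • jetLM n k (e p)) μ := by
    refine (hi k).mono' (ha.smul ((continuous_jetLM n k).comp he).aestronglyMeasurable)
      (Eventually.of_forall fun p => ?_)
    rw [norm_smul, norm_jetLM]
  have hJ : jetLM n k φ = ∫ p, a p • jetLM n k (e p) ∂μ := by
    refine JetSpace.ext_eval fun m t => ?_
    set ev := JetSpace.eval n k m t
    rw [← ev.integral_comp_comm hint]
    have hev : ∀ p, ev (a p • jetLM n k (e p)) =
        Real.exp (k * ‖t‖) • a p • iteratedFDeriv ℝ m (e p) t := fun p => by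
      rw [map_smul, smul_comm, JetSpace.eval_jetLM]
    simp only [hev]
    rw [integral_smul, ← iteratedFDeriv_integral ha he hi, JetSpace.eval_jetLM,
      funext hφ]
  rw [← hF φ, hJ, ← F.integral_comp_comm hint]
  simp only [map_smul, hF, smul_eq_mul]

end K1

/-! ### Decay of the coefficients with respect to time-frequency shifts -/

open FourierTransform in
/-- Decay of the inverse Fourier transform of a test function, quantified by the `L¹` norms of
derivatives. -/
lemma norm_fourierInv_le {n : ℕ} {u : Rn n → ℂ} (hu : ContDiff ℝ (⊤ : ℕ∞) u)
    (hc : HasCompactSupport u) (N : ℕ) (ξ : Rn n) :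
    (1 + ‖ξ‖) ^ N * ‖𝓕⁻ u ξ‖ ≤
      3 ^ N * ∑ j ∈ Finset.range (N + 1), ∫ t, ‖iteratedFDeriv ℝ j u t‖ := by
  have hint : ∀ j : ℕ, Integrable fun t => ‖iteratedFDeriv ℝ j u t‖ := fun j =>
    ((hu.continuous_iteratedFDeriv (m := j) (mod_cast le_top)).integrable_of_hasCompactSupport
      (hc.iteratedFDeriv j)).norm
  set S := ∑ j ∈ Finset.range (N + 1), ∫ t, ‖iteratedFDeriv ℝ j u t‖
  have key : ∀ m ≤ N, ‖ξ‖ ^ m * ‖𝓕⁻ u ξ‖ ≤ 2 ^ m * S := by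
    intro m hm
    have h := Real.pow_mul_norm_iteratedFDeriv_fourier_le (K := 0) (N := (⊤ : ℕ∞)) hu
      (fun k j hk _ => by
        obtain rfl : k = 0 := by simpa using hk
        simpa using hint j) (k := 0) (n := m) (by simp) (mod_cast le_top) (-ξ)
    rw [norm_neg, norm_iteratedFDeriv_zero, ← Real.fourierInv_eq_fourier_neg] at h
    refine h.trans ?_
    simp only [pow_zero, one_mul, Nat.cast_zero, mul_zero, zero_add, Finset.range_one,
      Finset.singleton_product, Finset.sum_map, Function.Embedding.coeFn_mk]
    gcongr
    refine Finset.sum_le_sum_of_subset_of_nonneg ?_ fun j _ _ => by positivity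
    exact Finset.range_mono (by omega)
  -- The binomial theorem turns the bounds `2 ^ m * S` into `(2 + 1) ^ N * S`.
  calc (1 + ‖ξ‖) ^ N * ‖𝓕⁻ u ξ‖
      = ∑ m ∈ Finset.range (N + 1), (‖ξ‖ ^ m * ‖𝓕⁻ u ξ‖) * N.choose m := by
        rw [add_comm, add_pow, Finset.sum_mul]
        refine Finset.sum_congr rfl fun m _ => ?_
        rw [one_pow]
        ring
    _ ≤ ∑ m ∈ Finset.range (N + 1), (2 ^ m * S) * N.choose m := by
        refine Finset.sum_le_sum fun m hm => ?_
        have := key m (Nat.le_of_lt_succ (Finset.mem_range.1 hm))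
        gcongr
    _ = 3 ^ N * S := by
        rw [show (3 : ℝ) = 2 + 1 by norm_num, add_pow, Finset.sum_mul]
        refine Finset.sum_congr rfl fun m _ => ?_
        rw [one_pow]
        ring

namespace ExpModerateWeight

variable {n : ℕ} (ω : ExpModerateWeight n)

/-- The integrable function `(1 + |t|)^{-(n+1)}`. -/
def bracket (n : ℕ) (t : Rn n) : ℝ := (1 + ‖t‖) ^ (-((n + 1 : ℕ) : ℝ))

lemma bracket_eq (t : Rn n) : bracket n t = ((1 + ‖t‖) ^ (n + 1))⁻¹ := by
  rw [bracket, Real.rpow_neg (by positivity), Real.rpow_natCast]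

lemma bracket_pos (t : Rn n) : 0 < bracket n t := by
  rw [bracket_eq]
  positivity

lemma bracket_le_one (t : Rn n) : bracket n t ≤ 1 := by
  rw [bracket_eq]
  exact inv_le_one_of_one_le₀ (one_le_pow₀ (by linarith [norm_nonneg t]))

lemma continuous_bracket (n : ℕ) : Continuous (bracket n) := by
  have : bracket n = fun t => ((1 + ‖t‖) ^ (n + 1))⁻¹ := funext bracket_eq
  rw [this]
  exact (by fun_prop : Continuous fun t : Rn n => (1 + ‖t‖) ^ (n + 1)).inv₀
    fun t => by positivity

lemma integrable_bracket_fun (n : ℕ) : Integrable (bracket n) := integrable_bracket n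

lemma exp_neg_le_bracket {b : ℝ} (hb : ((n + 1 : ℕ) : ℝ) ≤ b) (t : Rn n) :
    Real.exp (-(b * ‖t‖)) ≤ bracket n t := by
  rw [bracket_eq, Real.exp_neg]
  refine inv_anti₀ (by positivity) ?_
  calc (1 + ‖t‖) ^ (n + 1) ≤ Real.exp ‖t‖ ^ (n + 1) := by
        gcongr
        linarith [Real.add_one_le_exp ‖t‖]
    _ = Real.exp ((n + 1 : ℕ) * ‖t‖) := by rw [← Real.exp_nat_mul]
    _ ≤ _ := by gcongr

/-- The sum of the norms of the derivatives of order at most `N`, times the weight. -/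
def jetNorm (N : ℕ) (θ : DL1 ω) (t : Rn n) : ℝ :=
  ∑ i ∈ Finset.range (N + 1), ‖iteratedFDeriv ℝ i θ t‖ * ω t

variable {ω}

lemma jetNorm_nonneg (N : ℕ) (θ : DL1 ω) (t : Rn n) : 0 ≤ ω.jetNorm N θ t :=
  Finset.sum_nonneg fun _ _ => mul_nonneg (norm_nonneg _) (ω.pos' t).le

lemma integrable_jetNorm (N : ℕ) (θ : DL1 ω) : Integrable (ω.jetNorm N θ) :=
  integrable_finsetSum _ fun i _ => θ.integrable i

lemma integral_jetNorm_le (N : ℕ) (θ : DL1 ω) :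
    ∫ t, ω.jetNorm N θ t ≤ (N + 1) * DL1.normFamily ω N θ := by
  unfold jetNorm
  rw [integral_finsetSum _ fun i _ => θ.integrable i]
  calc _ ≤ ∑ i ∈ Finset.range (N + 1), DL1.normFamily ω N θ := by
        refine Finset.sum_le_sum fun i hi => ?_
        exact (Finset.le_sup (f := DL1.normAux ω) hi : DL1.normAux ω i ≤ _) θ
    _ = _ := by simp

variable (ω) in
/-- The convolution of `jetNorm` with the integrable function `bracket`. -/
def jetConv (N : ℕ) (θ : DL1 ω) (x : Rn n) : ℝ := ∫ t, ω.jetNorm N θ t * bracket n (x - t)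

lemma integrable_jetNorm_mul_bracket (N : ℕ) (θ : DL1 ω) (x : Rn n) :
    Integrable fun t => ω.jetNorm N θ t * bracket n (x - t) :=
  (integrable_jetNorm N θ).mul_bdd
    ((continuous_bracket n).comp (continuous_const.sub continuous_id)).aestronglyMeasurable
    (c := 1) (Eventually.of_forall fun t => by
      rw [Real.norm_of_nonneg (bracket_pos _).le]; exact bracket_le_one _)

lemma integrable_jetConv (N : ℕ) (θ : DL1 ω) : Integrable (ω.jetConv N θ) :=
  (integrable_jetNorm N θ).integrable_convolution (ContinuousLinearMap.mul ℝ ℝ)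
    (integrable_bracket_fun n)

lemma integral_jetConv (N : ℕ) (θ : DL1 ω) :
    ∫ x, ω.jetConv N θ x = (∫ t, ω.jetNorm N θ t) * ∫ t, bracket n t :=
  integral_convolution (ContinuousLinearMap.mul ℝ ℝ) (integrable_jetNorm N θ)
    (integrable_bracket_fun n)

end ExpModerateWeight

namespace K1

open ExpModerateWeight

variable {n : ℕ}

/-- The coefficients `∫ θ(t) M_ξ T_x γ(t) dt`, `p = (x, ξ)`, of `θ` with respect to the
time-frequency shifts of `γ`. -/
def coeff (γ : K1 n) (θ : Rn n → ℂ) (p : Rn n × Rn n) : ℂ := ∫ t, θ t * tfShift γ p t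

open FourierTransform in
lemma coeff_eq_fourierInv (γ : K1 n) (θ : Rn n → ℂ) (x ξ : Rn n) :
    coeff γ θ (x, ξ) = 𝓕⁻ (fun t => θ t * γ (t - x)) ξ := by
  rw [Real.fourierInv_eq']
  refine integral_congr_ae (Eventually.of_forall fun t => ?_)
  simp only [tfShift_apply, character, smul_eq_mul, real_inner_comm t ξ]
  push_cast
  ring_nf

lemma continuous_uncurry_tfShift (γ : K1 n) :
    Continuous fun q : (Rn n × Rn n) × Rn n => tfShift γ q.1 q.2 := by
  simp only [tfShift_apply, character]
  have := γ.smooth.continuous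
  fun_prop

lemma stronglyMeasurable_coeff (γ : K1 n) {θ : Rn n → ℂ} (hθ : Continuous θ) :
    StronglyMeasurable (coeff γ θ) := by
  refine StronglyMeasurable.integral_prod_right' (f := fun q : (Rn n × Rn n) × Rn n =>
    θ q.2 * tfShift γ q.1 q.2) (Continuous.stronglyMeasurable ?_)
  exact (hθ.comp continuous_snd).mul (continuous_uncurry_tfShift γ)

lemma hasCompactSupport_mul_translate {γ : K1 n} (hγ : HasCompactSupport γ) (θ : Rn n → ℂ)
    (x : Rn n) : HasCompactSupport fun t => θ t * γ (t - x) :=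
  HasCompactSupport.mul_left (hγ.comp_homeomorph (Homeomorph.subRight x))

/-- Weighted decay of the coefficients of `θ ∈ 𝒟_{L¹_ω}`. -/
lemma exists_coeff_le (ω : ExpModerateWeight n) {γ : K1 n} (hγ : HasCompactSupport γ) (N : ℕ) :
    ∃ C : ℝ, 0 ≤ C ∧ ∀ (θ : DL1 ω) (p : Rn n × Rn n),
      ω p.1 * ((1 + ‖p.2‖) ^ N * ‖coeff γ θ p‖) ≤ C * ω.jetConv N θ p.1 := by
  obtain ⟨A, hA, a, ha, hω⟩ := ω.moderate'
  -- With this `k` the decay `e^{-k|t-x|}` of `γ(t - x)` beats the factor `e^{a|x-t|}` by which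
  -- `ω(x)` may exceed `A ω(t)`, up to the integrable function `bracket`.
  set k := ⌈a⌉₊ + (n + 1) + N
  have hk : a + (n + 1 : ℕ) ≤ k := by
    have := Nat.le_ceil a
    simp only [k]
    push_cast
    linarith [(Nat.cast_nonneg N : (0 : ℝ) ≤ N)]
  have hν := apply_nonneg (nu n k) γ
  set D := 2 ^ N * (A * nu n k γ)
  refine ⟨3 ^ N * ((N + 1 : ℕ) * D), by positivity, ?_⟩
  rintro θ ⟨x, ξ⟩
  rw [coeff_eq_fourierInv]
  set u : Rn n → ℂ := fun t => θ t * γ (t - x)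
  have hγx : ContDiff ℝ (⊤ : ℕ∞) fun t => γ (t - x) :=
    γ.smooth.comp (contDiff_id.sub contDiff_const)
  have hu : ContDiff ℝ (⊤ : ℕ∞) u := θ.smooth.mul hγx
  have hωx := ω.pos' x
  have hbound : ∀ j ≤ N, ∀ t, ω x * ‖iteratedFDeriv ℝ j u t‖ ≤
      D * (ω.jetNorm N θ t * bracket n (x - t)) := by
    intro j hj t
    have h1 := norm_iteratedFDeriv_mul_le (𝕜 := ℝ) θ.smooth hγx t (n := j) (mod_cast le_top)
    have h2 : ω x ≤ A * ω t * Real.exp (a * ‖x - t‖) := by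
      have := hω (x - t) t
      rwa [sub_add_cancel] at this
    have hexp : Real.exp (a * ‖x - t‖) * Real.exp (-(k * ‖t - x‖)) ≤ bracket n (x - t) := by
      refine le_trans (le_of_eq ?_) (exp_neg_le_bracket (b := k - a) (by linarith) (x - t))
      rw [← Real.exp_add, norm_sub_rev t x]
      ring_nf
    have hωt := ω.pos' t
    calc ω x * ‖iteratedFDeriv ℝ j u t‖
        ≤ ω x * ∑ i ∈ Finset.range (j + 1), (j.choose i : ℝ) * ‖iteratedFDeriv ℝ i θ t‖ *
          ‖iteratedFDeriv ℝ (j - i) (fun t => γ (t - x)) t‖ := by gcongr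
      _ ≤ ω x * ∑ i ∈ Finset.range (j + 1), (2 : ℝ) ^ N * ‖iteratedFDeriv ℝ i θ t‖ *
          (nu n k γ * Real.exp (-(k * ‖t - x‖))) := by
        gcongr with i hi
        · calc (j.choose i : ℝ) ≤ (2 : ℝ) ^ j := by exact_mod_cast Nat.choose_le_two_pow j i
            _ ≤ 2 ^ N := by gcongr; norm_num
        · rw [iteratedFDeriv_comp_sub]
          exact norm_iteratedFDeriv_le (by omega) γ _
      _ ≤ ω x * ∑ i ∈ Finset.range (N + 1), (2 : ℝ) ^ N * ‖iteratedFDeriv ℝ i θ t‖ *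
          (nu n k γ * Real.exp (-(k * ‖t - x‖))) := by
        gcongr
      _ ≤ (A * ω t * Real.exp (a * ‖x - t‖)) *
          ∑ i ∈ Finset.range (N + 1), (2 : ℝ) ^ N * ‖iteratedFDeriv ℝ i θ t‖ *
          (nu n k γ * Real.exp (-(k * ‖t - x‖))) := by
        gcongr
      _ = D * ((∑ i ∈ Finset.range (N + 1), ‖iteratedFDeriv ℝ i θ t‖ * ω t) *
          (Real.exp (a * ‖x - t‖) * Real.exp (-(k * ‖t - x‖)))) := by
        rw [Finset.mul_sum, Finset.sum_mul, Finset.mul_sum]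
        refine Finset.sum_congr rfl fun i _ => ?_
        simp only [D]
        ring
      _ ≤ _ := by
        have := jetNorm_nonneg N θ t
        unfold jetNorm at *
        gcongr
  have hint : ∀ j ≤ N, ω x * ∫ t, ‖iteratedFDeriv ℝ j u t‖ ≤ D * ω.jetConv N θ x := by
    intro j hj
    rw [← integral_const_mul, jetConv, ← integral_const_mul]
    exact integral_mono_of_nonneg
      (Eventually.of_forall fun t => mul_nonneg hωx.le (norm_nonneg _))
      ((integrable_jetNorm_mul_bracket N θ x).const_mul _)
      (Eventually.of_forall fun t => hbound j hj t)
  calc _ ≤ ω x * (3 ^ N * ∑ j ∈ Finset.range (N + 1), ∫ t, ‖iteratedFDeriv ℝ j u t‖) := by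
        have := norm_fourierInv_le hu (hasCompactSupport_mul_translate hγ θ x) N ξ
        gcongr
    _ = 3 ^ N * ∑ j ∈ Finset.range (N + 1), ω x * ∫ t, ‖iteratedFDeriv ℝ j u t‖ := by
        rw [← Finset.mul_sum]
        ring
    _ ≤ 3 ^ N * ∑ j ∈ Finset.range (N + 1), D * ω.jetConv N θ x := by
        refine mul_le_mul_of_nonneg_left (Finset.sum_le_sum fun j hj => ?_) (by positivity)
        exact hint j (Nat.le_of_lt_succ (Finset.mem_range.1 hj))
    _ = _ := by
        rw [Finset.sum_const, Finset.card_range, nsmul_eq_mul]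
        ring

/-- A function of moderate growth on phase space pairs with the coefficients of
`θ ∈ 𝒟_{L¹_ω}`. -/
lemma exists_integral_mul_coeff_le (ω : ExpModerateWeight n) {γ : K1 n}
    (hγ : HasCompactSupport γ) (s : ℕ) : ∃ (N : ℕ) (C : ℝ), 0 ≤ C ∧
      ∀ (V : Rn n × Rn n → ℂ) (M : ℝ), AEStronglyMeasurable V →
        (∀ p, ‖V p‖ ≤ M * (ω p.1 * (1 + ‖p.2‖) ^ s)) → ∀ θ : DL1 ω,
          Integrable (fun p => V p * coeff γ θ p) ∧
          ‖∫ p, V p * coeff γ θ p‖ ≤ M * (C * DL1.normFamily ω N θ) := by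
  obtain ⟨C, hC, h⟩ := exists_coeff_le ω hγ (s + (n + 1))
  have hb : 0 ≤ ∫ t, bracket n t := integral_nonneg fun t => (bracket_pos t).le
  refine ⟨s + (n + 1), C * (((s + (n + 1) : ℕ) + 1) * (∫ t, bracket n t) * ∫ t, bracket n t),
    by positivity, fun V M hV hVM θ => ?_⟩
  set N := s + (n + 1)
  have hM : 0 ≤ M := by
    have h0 := (norm_nonneg _).trans (hVM (0, 0))
    have := ω.pos' 0
    refine nonneg_of_mul_nonneg_left h0 ?_
    simpa using this
  have hle : ∀ p, ‖V p * coeff γ θ p‖ ≤ M * C * (ω.jetConv N θ p.1 * bracket n p.2) := by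
    intro p
    have h1 := h θ p
    have h2 := ω.pos' p.1
    have h3 : (0 : ℝ) < (1 + ‖p.2‖) ^ (n + 1) := by positivity
    rw [norm_mul, bracket_eq, ← mul_assoc, ← div_eq_mul_inv, le_div_iff₀ h3]
    calc ‖V p‖ * ‖coeff γ θ p‖ * (1 + ‖p.2‖) ^ (n + 1)
        ≤ M * (ω p.1 * (1 + ‖p.2‖) ^ s) * ‖coeff γ θ p‖ * (1 + ‖p.2‖) ^ (n + 1) := by
          gcongr
          exact hVM p
      _ = M * (ω p.1 * ((1 + ‖p.2‖) ^ N * ‖coeff γ θ p‖)) := by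
          rw [pow_add]
          ring
      _ ≤ M * (C * ω.jetConv N θ p.1) := by gcongr
      _ = _ := by ring
  have hdom : Integrable fun p : Rn n × Rn n =>
      M * C * (ω.jetConv N θ p.1 * bracket n p.2) :=
    ((integrable_jetConv N θ).mul_prod (integrable_bracket_fun n)).const_mul _
  refine ⟨hdom.mono' (hV.mul (stronglyMeasurable_coeff γ θ.smooth.continuous).aestronglyMeasurable)
    (Eventually.of_forall hle), ?_⟩
  refine (norm_integral_le_of_norm_le hdom (Eventually.of_forall hle)).trans ?_
  rw [integral_const_mul, Measure.volume_eq_prod, integral_prod_mul, integral_jetConv]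
  have := integral_jetNorm_le N θ
  calc _ ≤ M * C * (((N + 1) * DL1.normFamily ω N θ) * (∫ t, bracket n t) *
        ∫ t, bracket n t) := by gcongr
    _ = _ := by ring

end K1

/-! ### Synthesis and reconstruction -/

namespace K1

open ExpModerateWeight

variable {n : ℕ}

lemma coeff_add {ω : ExpModerateWeight n} {γ : K1 n} (hγ : HasCompactSupport γ) (θ₁ θ₂ : DL1 ω)
    (p : Rn n × Rn n) : coeff γ (θ₁ + θ₂) p = coeff γ θ₁ p + coeff γ θ₂ p := by
  have hi : ∀ θ : DL1 ω, Integrable fun t => θ t * tfShift γ p t := fun θ => by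
    refine (θ.smooth.continuous.mul (tfShift γ p).smooth.continuous).integrable_of_hasCompactSupport
      (HasCompactSupport.mul_left ?_)
    exact hasCompactSupport_mul_translate hγ _ _
  simp only [coeff]
  rw [← integral_add (hi θ₁) (hi θ₂)]
  simp only [Pi.add_apply, add_mul]

lemma coeff_smul (γ : K1 n) (c : ℂ) (θ : Rn n → ℂ) (p : Rn n × Rn n) :
    coeff γ (c • θ) p = c * coeff γ θ p := by
  simp only [coeff, ← integral_const_mul, Pi.smul_apply, smul_eq_mul, mul_assoc]

/-- The synthesis functionals `θ ↦ ∫ V(p) coeff γ θ p dp` on `𝒟_{L¹_ω}`, for functions `V` of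
moderate growth on phase space. -/
lemma exists_synthesis (ω : ExpModerateWeight n) {γ : K1 n} (hγ : HasCompactSupport γ) (s : ℕ) :
    ∃ (N : ℕ) (C : ℝ), 0 ≤ C ∧ ∀ (V : Rn n × Rn n → ℂ) (M : ℝ), AEStronglyMeasurable V →
      (∀ p, ‖V p‖ ≤ M * (ω p.1 * (1 + ‖p.2‖) ^ s)) → ∃ g : ω.BDual,
        (∀ θ, g θ = ∫ p, V p * coeff γ θ p) ∧
        ∀ θ, ‖g θ‖ ≤ M * (C * DL1.normFamily ω N θ) := by
  obtain ⟨N, C, hC, h⟩ := exists_integral_mul_coeff_le ω hγ s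
  refine ⟨N, C, hC, fun V M hV hVM => ?_⟩
  have h' := h V M hV hVM
  have hM : 0 ≤ M := by
    have h0 := (norm_nonneg _).trans (hVM (0, 0))
    have := ω.pos' 0
    refine nonneg_of_mul_nonneg_left h0 ?_
    simpa using this
  let gL : DL1 ω →ₗ[ℂ] ℂ :=
    { toFun := fun θ => ∫ p, V p * coeff γ θ p
      map_add' := fun θ₁ θ₂ => by
        rw [← integral_add (h' θ₁).1 (h' θ₂).1]
        simp only [DL1.coe_add, coeff_add hγ, mul_add]
      map_smul' := fun c θ => by
        rw [RingHom.id_apply, smul_eq_mul, ← integral_const_mul]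
        simp only [DL1.coe_smul, coeff_smul, mul_left_comm] }
  have hcont : Continuous gL := by
    refine WithSeminorms.continuous_normedSpace_rng ℂ (DL1.withSeminorms ω) gL
      ⟨{N}, ⟨M * C, mul_nonneg hM hC⟩, ?_⟩
    intro θ
    rw [Finset.sup_singleton]
    change ‖gL θ‖ ≤ M * C * DL1.normFamily ω N θ
    rw [mul_assoc]
    exact (h' θ).2
  exact ⟨⟨gL, hcont⟩, fun θ => rfl, fun θ => (h' θ).2⟩

/-- The exponential weight `e^{k|x|}`. -/
def expWeight (n k : ℕ) : ExpModerateWeight n where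
  toFun x := Real.exp (k * ‖x‖)
  pos' x := Real.exp_pos _
  measurable' := by fun_prop
  moderate' := ⟨1, one_pos, k, Nat.cast_nonneg k, fun x y => by
    rw [one_mul, ← Real.exp_add, ← mul_add]
    gcongr
    rw [add_comm ‖y‖]
    exact norm_add_le x y⟩

/-- The coefficients of a function in `𝒦₁` decay faster than any norm of the time-frequency
shifts grows. -/
lemma integrable_norm_coeff_mul_nu {γ : K1 n} (hγ : HasCompactSupport γ) (φ : K1 n)
    {e : Rn n × Rn n → K1 n} (he : Continuous e) (χ : K1 n)
    (hχ : ∀ k p, nu n k (e p) = nu n k (tfShift χ p)) (k : ℕ) :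
    Integrable fun p => ‖coeff γ φ p‖ * nu n k (e p) := by
  obtain ⟨N, C, -, h⟩ := exists_integral_mul_coeff_le (expWeight n k) hγ k
  have hpi := Real.pi_pos
  have hcont : Continuous fun p => nu n k (e p) :=
    ((withSeminorms n).continuous_seminorm k).comp he
  have h1 := (h (fun p => ((nu n k (e p) : ℝ) : ℂ)) ((4 * Real.pi) ^ k * nu n k χ)
    (Complex.continuous_ofReal.comp hcont).aestronglyMeasurable (fun p => by
      rw [Complex.norm_real, Real.norm_of_nonneg (apply_nonneg _ _), hχ]
      refine (nu_tfShift_le k χ p).trans (le_of_eq ?_)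
      change _ = _ * (Real.exp (k * ‖p.1‖) * _)
      rw [mul_pow]
      ring) ((expWeight n k).inclusion φ)).1.norm
  refine h1.congr (Eventually.of_forall fun p => ?_)
  simp only [norm_mul, Complex.norm_real, Real.norm_of_nonneg (apply_nonneg (nu n k) (e p))]
  exact mul_comm _ _

lemma continuous_conj_tfShift (ψ : K1 n) : Continuous fun p => conj (tfShift ψ p) := by
  have : (fun p => conj (tfShift ψ p)) = fun p => tfShift (conj ψ) (p.1, -p.2) :=
    funext fun p => conj_tfShift ψ p.1 p.2
  rw [this]
  exact (continuous_tfShift (conj ψ)).comp (by fun_prop)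

open FourierTransform in
/-- The inversion formula for the short-time Fourier transform with window `γ` of a function in
`𝒦₁`, with synthesis window `ψ`, at a point. -/
lemma integral_coeff_mul_conj_tfShift {γ : K1 n} (hγ : HasCompactSupport γ) (ψ φ : K1 n)
    (t : Rn n) : ∫ p, coeff γ φ p * conj (tfShift ψ p) t =
      (∫ y, γ y * (starRingEnd ℂ) (ψ y)) * φ t := by
  have hint := integrable_mul_apply
    (stronglyMeasurable_coeff γ φ.smooth.continuous).aestronglyMeasurable
    (continuous_conj_tfShift ψ)
    (integrable_norm_coeff_mul_nu hγ φ (continuous_conj_tfShift ψ) ψ fun k p => nu_conj k _) t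
  rw [Measure.volume_eq_prod] at hint ⊢
  rw [integral_prod _ hint]
  -- For fixed `x` the coefficients are the inverse Fourier transform of `φ γ(· - x)`, so that the
  -- integral in `ξ` is computed by Fourier inversion.
  have hinner : ∀ x, ∫ ξ, coeff γ φ (x, ξ) * conj (tfShift ψ (x, ξ)) t =
      φ t * (γ (t - x) * (starRingEnd ℂ) (ψ (t - x))) := by
    intro x
    set u : Rn n → ℂ := fun t => φ t * γ (t - x)
    have hu : ContDiff ℝ (⊤ : ℕ∞) u :=
      φ.smooth.mul (γ.smooth.comp (contDiff_id.sub contDiff_const))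
    have huc : HasCompactSupport u := hasCompactSupport_mul_translate hγ φ x
    have hui : Integrable u := hu.continuous.integrable_of_hasCompactSupport huc
    have hinv : Integrable (𝓕⁻ u) := by
      refine ((integrable_bracket_fun n).const_mul (3 ^ (n + 1) *
        ∑ j ∈ Finset.range (n + 1 + 1), ∫ t, ‖iteratedFDeriv ℝ j u t‖)).mono' ?_
        (Eventually.of_forall fun ξ => ?_)
      · have : StronglyMeasurable fun ξ => coeff γ φ (x, ξ) :=
          (stronglyMeasurable_coeff γ φ.smooth.continuous).comp_measurable
            (measurable_const.prodMk measurable_id)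
        simp only [coeff_eq_fourierInv] at this
        exact this.aestronglyMeasurable
      · rw [bracket_eq, ← div_eq_mul_inv, le_div_iff₀ (by positivity), mul_comm]
        exact norm_fourierInv_le hu huc (n + 1) ξ
    have hF : 𝓕 (𝓕⁻ u) t = u t := by
      refine hui.fourier_fourierInv_eq ?_ hu.continuous.continuousAt
      have : 𝓕 u = fun ξ => 𝓕⁻ u (-ξ) := funext fun ξ => by
        rw [Real.fourierInv_eq_fourier_neg, neg_neg]
      rw [this]
      exact hinv.comp_neg
    calc _ = ∫ ξ, (starRingEnd ℂ) (ψ (t - x)) *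
          (cexp ((↑(-2 * Real.pi * inner ℝ ξ t) * I)) • 𝓕⁻ u ξ) := by
          refine integral_congr_ae (Eventually.of_forall fun ξ => ?_)
          simp only [conj_apply, tfShift_apply, map_mul, conj_character]
          simp only [coeff_eq_fourierInv, character, inner_neg_left, smul_eq_mul, u]
          push_cast
          ring_nf
      _ = (starRingEnd ℂ) (ψ (t - x)) * 𝓕 (𝓕⁻ u) t := by
          rw [integral_const_mul, Real.fourier_eq']
      _ = _ := by
          rw [hF]
          simp only [u]
          ring
  simp only [hinner]
  rw [integral_const_mul, integral_sub_left_eq_self (fun y => γ y * (starRingEnd ℂ) (ψ y)),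
    mul_comm]

lemma continuous_stft (ψ : K1 n) (f : K1Dual n) :
    Continuous fun p : Rn n × Rn n => stft ψ f p.1 p.2 :=
  f.continuous.comp (continuous_conj_tfShift ψ)

/-- Reconstruction of a distribution from its short-time Fourier transform. -/
lemma integral_stft_mul_coeff {γ : K1 n} (hγ : HasCompactSupport γ) (ψ φ : K1 n)
    (f : K1Dual n) : ∫ p : Rn n × Rn n, stft ψ f p.1 p.2 * coeff γ φ p =
      (∫ y, γ y * (starRingEnd ℂ) (ψ y)) * f φ := by
  have h := map_integral (φ := (∫ y, γ y * (starRingEnd ℂ) (ψ y)) • φ) f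
    (stronglyMeasurable_coeff γ φ.smooth.continuous).aestronglyMeasurable
    (continuous_conj_tfShift ψ)
    (integrable_norm_coeff_mul_nu hγ φ (continuous_conj_tfShift ψ) ψ fun k p => nu_conj k _)
    fun t => (integral_coeff_mul_conj_tfShift hγ ψ φ t).symm
  rw [map_smul, smul_eq_mul] at h
  rw [h]
  exact integral_congr_ae (Eventually.of_forall fun p => mul_comm _ _)

/-- A nonzero `ψ ∈ 𝒦₁` has a compactly supported dual window. -/
lemma exists_dual_window {ψ : K1 n} (hψ : ψ ≠ 0) :
    ∃ γ : K1 n, HasCompactSupport γ ∧ ∫ y, γ y * (starRingEnd ℂ) (ψ y) ≠ 0 := by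
  obtain ⟨t₀, ht₀⟩ : ∃ t, ψ t ≠ 0 := by
    by_contra! h
    exact hψ (DFunLike.ext _ _ h)
  -- With `γ = b ψ` for a bump function `b` around `t₀`, the integral is `∫ b |ψ|² > 0`.
  let b : ContDiffBump t₀ := default
  have hb : ContDiff ℝ (⊤ : ℕ∞) fun t => (b t : ℂ) := Complex.ofRealCLM.contDiff.comp b.contDiff
  have hbc : HasCompactSupport fun t => (b t : ℂ) :=
    b.hasCompactSupport.comp_left (g := ((↑) : ℝ → ℂ)) Complex.ofReal_zero
  have hc : HasCompactSupport fun t => (b t : ℂ) * ψ t := hbc.mul_right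
  have hs : ContDiff ℝ (⊤ : ℕ∞) fun t => (b t : ℂ) * ψ t := hb.mul ψ.smooth
  let γ : K1 n := ⟨fun t => (b t : ℂ) * ψ t, hs, fun k m => by
    have hcont : Continuous fun t : Rn n => Real.exp (k * ‖t‖) •
        iteratedFDeriv ℝ m (fun t => (b t : ℂ) * ψ t) t :=
      (by fun_prop : Continuous fun t : Rn n => Real.exp (k * ‖t‖)).smul
        (hs.continuous_iteratedFDeriv (m := m) (mod_cast le_top))
    obtain ⟨C, hC⟩ := hcont.bounded_above_of_compact_support ((hc.iteratedFDeriv m).smul_left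
      (f := fun t : Rn n => Real.exp (k * ‖t‖)))
    refine ⟨C, fun t => ?_⟩
    have := hC t
    rwa [norm_smul, Real.norm_of_nonneg (Real.exp_pos _).le] at this⟩
  refine ⟨γ, hc, ?_⟩
  have he : ∀ y, γ y * (starRingEnd ℂ) (ψ y) = ((b y * ‖ψ y‖ ^ 2 : ℝ) : ℂ) := fun y => by
    change (b y : ℂ) * ψ y * (starRingEnd ℂ) (ψ y) = _
    rw [mul_assoc, Complex.mul_conj, Complex.normSq_eq_norm_sq]
    push_cast
    rfl
  simp only [he]
  rw [integral_complex_ofReal, Complex.ofReal_ne_zero]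
  have hcont : Continuous fun y => b y * ‖ψ y‖ ^ 2 :=
    b.continuous.mul (ψ.smooth.continuous.norm.pow 2)
  refine (hcont.integral_pos_of_hasCompactSupport_nonneg_nonzero b.hasCompactSupport.mul_right
    (fun y => mul_nonneg b.nonneg (sq_nonneg _)) (x := t₀) ?_).ne'
  rw [b.one_of_mem_closedBall (Metric.mem_closedBall_self b.rIn_pos.le), one_mul]
  exact pow_ne_zero 2 (norm_ne_zero_iff.2 ht₀)

/-- The synthesis functional of a continuous function cut off to a ball of phase space is given
by a test function. -/
lemma exists_testFunction_eq_synthesis (ω : ExpModerateWeight n) {γ : K1 n}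
    (hγ : HasCompactSupport γ) {V : Rn n × Rn n → ℂ} (hV : Continuous V) (R : ℝ) :
    ∃ χ : 𝓓((⊤ : TopologicalSpace.Opens (Rn n)), ℂ), ∀ θ : DL1 ω, ω.ofTestFunction χ θ =
      ∫ p, (Metric.closedBall 0 R).indicator V p * coeff γ θ p := by
  set K : Set (Rn n × Rn n) := Metric.closedBall 0 R
  have hK : IsCompact K := isCompact_closedBall _ _
  obtain ⟨r, hr⟩ : ∃ r, tsupport γ ⊆ Metric.closedBall 0 r := hγ.isBounded.subset_closedBall 0
  have hzero : ∀ p ∈ K, ∀ t, t ∉ Metric.closedBall (0 : Rn n) (R + r) → tfShift γ p t = 0 := by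
    intro p hp t ht
    by_contra hne
    have hmem : t - p.1 ∈ tsupport γ := subset_tsupport _ fun h0 : γ (t - p.1) = 0 =>
      hne (by rw [tfShift_apply, h0, mul_zero])
    refine ht ?_
    have h1 := hr hmem
    rw [mem_closedBall_zero_iff] at h1 ⊢
    have h2 : ‖p.1‖ ≤ R := (norm_fst_le p).trans (mem_closedBall_zero_iff.1 hp)
    calc ‖t‖ = ‖p.1 + (t - p.1)‖ := by congr 1; abel
      _ ≤ _ := (norm_add_le _ _).trans (add_le_add h2 h1)
  have ha : AEStronglyMeasurable (K.indicator V) :=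
    hV.aestronglyMeasurable.indicator hK.measurableSet
  have hi : ∀ k, Integrable fun p => ‖K.indicator V p‖ * nu n k (tfShift γ p) := fun k => by
    have hc : Continuous fun p => ‖V p‖ * nu n k (tfShift γ p) :=
      hV.norm.mul (((withSeminorms n).continuous_seminorm k).comp (continuous_tfShift γ))
    have h1 := (hc.continuousOn.integrableOn_compact hK (μ := volume)).integrable_indicator
      hK.measurableSet
    refine h1.congr (Eventually.of_forall fun p => ?_)
    by_cases hp : p ∈ K <;> simp [hp]
  let G : Rn n → ℂ := fun t => ∫ p, K.indicator V p * tfShift γ p t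
  have hG : ContDiff ℝ (⊤ : ℕ∞) G := contDiff_integral ha (continuous_tfShift γ) hi
  have hGc : HasCompactSupport G := by
    refine HasCompactSupport.intro (isCompact_closedBall 0 (R + r)) fun t ht => ?_
    refine integral_eq_zero_of_ae (Eventually.of_forall fun p => ?_)
    by_cases hp : p ∈ K
    · simp [hzero p hp t ht]
    · simp [hp]
  refine ⟨⟨G, hG, hGc, fun _ _ => trivial⟩, fun θ => ?_⟩
  change ∫ t, (∫ p, K.indicator V p * tfShift γ p t) * θ t = _
  have hswap : Integrable (Function.uncurry fun (t : Rn n) (p : Rn n × Rn n) =>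
      K.indicator V p * tfShift γ p t * θ t) (volume.prod volume) := by
    set B := Metric.closedBall (0 : Rn n) (R + r)
    have hBK : IsCompact (B ×ˢ K) := (isCompact_closedBall _ _).prod hK
    have hc : Continuous fun q : Rn n × (Rn n × Rn n) => V q.2 * tfShift γ q.2 q.1 * θ q.1 :=
      ((hV.comp continuous_snd).mul ((continuous_uncurry_tfShift γ).comp
        (continuous_snd.prodMk continuous_fst))).mul (θ.smooth.continuous.comp continuous_fst)
    have h1 := (hc.continuousOn.integrableOn_compact hBK
      (μ := volume.prod volume)).integrable_indicator hBK.measurableSet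
    refine h1.congr (Eventually.of_forall fun q => ?_)
    obtain ⟨t, p⟩ := q
    by_cases hp : p ∈ K
    · by_cases ht : t ∈ B
      · simp [hp, ht, Function.uncurry]
      · simp [hp, ht, Function.uncurry, hzero p hp t ht]
    · simp [hp, Function.uncurry]
  simp_rw [← integral_mul_const]
  rw [integral_integral_swap hswap]
  refine integral_congr_ae (Eventually.of_forall fun p => ?_)
  simp only [coeff, ← integral_const_mul]
  refine integral_congr_ae (Eventually.of_forall fun t => ?_)
  simp only
  ring

end K1

/-! ### Strong duals and bounded sets -/

lemma hasBasis_cocompact_closedBall {X : Type*} [PseudoMetricSpace X] [ProperSpace X] (c : X) :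
    (cocompact X).HasBasis (fun _ : ℝ => True) fun r => (Metric.closedBall c r)ᶜ := by
  rw [← Metric.cobounded_eq_cocompact]
  exact Metric.hasBasis_cobounded_compl_closedBall c

lemma ContinuousLinearMap.tendsto_zero_iff_forall_isVonNBounded {E α : Type*} [AddCommGroup E]
    [Module ℂ E] [TopologicalSpace E] {F : α → E →L[ℂ] ℂ} {l : Filter α} :
    Tendsto F l (𝓝 0) ↔ ∀ S : Set E, Bornology.IsVonNBounded ℂ S → ∀ ε > 0,
      ∀ᶠ a in l, ∀ x ∈ S, ‖F a x‖ < ε := by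
  rw [(ContinuousLinearMap.hasBasis_nhds_zero_of_basis Metric.nhds_basis_ball).tendsto_right_iff]
  simp only [Set.mem_ofPred_eq, mem_ball_zero_iff, Prod.forall, and_imp]
  exact ⟨fun h S hS ε hε => h S ε hS hε, fun h S ε hS hε => h S hS ε hε⟩

lemma ContinuousLinearMap.isVonNBounded_range_iff {E α : Type*} [AddCommGroup E]
    [Module ℂ E] [TopologicalSpace E] {F : α → E →L[ℂ] ℂ} :
    Bornology.IsVonNBounded ℂ (Set.range F) ↔ ∀ S : Set E, Bornology.IsVonNBounded ℂ S →
      ∃ M : ℝ, ∀ a, ∀ x ∈ S, ‖F a x‖ ≤ M := by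
  rw [ContinuousLinearMap.isVonNBounded_iff]
  refine forall₂_congr fun S _ => ?_
  rw [NormedSpace.isVonNBounded_iff, isBounded_iff_forall_norm_le]
  refine exists_congr fun M => ?_
  simp only [Set.forall_mem_image2, Set.forall_mem_range]

/-- In the dual of a space whose topology is given by an increasing sequence of seminorms, strongly
bounded sets are equicontinuous.  If not, there are functionals `F (i k)` and points `x k` with
`p k (x k) ≤ 1` and `‖F (i k) (x k)‖ = k`; but the points `x k` form a bounded set. -/
lemma WithSeminorms.exists_norm_le_of_isVonNBounded {E α : Type*} [AddCommGroup E]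
    [Module ℂ E] [TopologicalSpace E] {p : SeminormFamily ℂ E ℕ} (hp : WithSeminorms p)
    (hm : Monotone p) {F : α → E →L[ℂ] ℂ} (hF : Bornology.IsVonNBounded ℂ (Set.range F)) :
    ∃ (k : ℕ) (C : ℝ), 0 ≤ C ∧ ∀ a x, ‖F a x‖ ≤ C * p k x := by
  by_contra! hcon
  have hex : ∀ k : ℕ, ∃ a x, ‖F a x‖ = k ∧ p k x ≤ 1 := by
    intro k
    obtain ⟨a, x, hx⟩ := hcon k k (Nat.cast_nonneg k)
    have hpos : 0 < ‖F a x‖ :=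
      lt_of_le_of_lt (mul_nonneg (Nat.cast_nonneg k) (apply_nonneg _ _)) hx
    have hc : ‖((k / ‖F a x‖ : ℝ) : ℂ)‖ = k / ‖F a x‖ := by
      rw [Complex.norm_real, Real.norm_of_nonneg (by positivity)]
    refine ⟨a, ((k / ‖F a x‖ : ℝ) : ℂ) • x, ?_, ?_⟩
    · rw [map_smul, norm_smul, hc, div_mul_cancel₀ _ hpos.ne']
    · rw [map_smul_eq_mul, hc, div_mul_eq_mul_div, div_le_one hpos]
      exact hx.le
  choose i x hx hpx using hex
  have hb : Bornology.IsVonNBounded ℂ (Set.range x) := by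
    refine hp.isVonNBounded_iff_seminorm_bounded.2 fun j => ?_
    have h0 : ∀ k, 0 ≤ p j (x k) := fun k => apply_nonneg _ _
    have hs : 0 ≤ ∑ k ∈ Finset.range j, p j (x k) := Finset.sum_nonneg fun k _ => h0 k
    refine ⟨∑ k ∈ Finset.range j, p j (x k) + 2, by linarith, ?_⟩
    rintro _ ⟨k, rfl⟩
    rcases lt_or_ge k j with hk | hk
    · have := Finset.single_le_sum (f := fun k => p j (x k)) (fun k _ => h0 k)
        (Finset.mem_range.2 hk)
      linarith
    · have : p j (x k) ≤ p k (x k) := hm hk (x k)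
      linarith [hpx k]
  obtain ⟨M, hM⟩ := ContinuousLinearMap.isVonNBounded_range_iff.1 hF _ hb
  obtain ⟨k, hk⟩ := exists_nat_gt M
  have := hM (i k) (x k) ⟨k, rfl⟩
  rw [hx] at this
  linarith

/-! ### Translates of `ω`-bounded distributions -/

namespace DL1

variable {n : ℕ} {ω : ExpModerateWeight n}

lemma normFamily_mono (ω : ExpModerateWeight n) : Monotone (normFamily ω) := fun _ _ h =>
  Finset.sup_mono (Finset.range_mono (Nat.succ_le_succ h))

end DL1

namespace ExpModerateWeight

variable {n : ℕ} (ω : ExpModerateWeight n)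

/-- The normalized translates `T_{-h} f / ω(h)`. -/
def normalizedTranslate (f : K1Dual n) (h : Rn n) : K1Dual n :=
  (ω h)⁻¹ • K1Dual.translate (-h) f

lemma normalizedTranslate_apply (f : K1Dual n) (h : Rn n) (φ : K1 n) :
    ω.normalizedTranslate f h φ = ((ω h)⁻¹ : ℝ) • f (K1.translate h φ) := by
  change (ω h)⁻¹ • f (K1.translate (- -h) φ) = _
  rw [neg_neg]

lemma norm_normalizedTranslate_apply (f : K1Dual n) (h : Rn n) (φ : K1 n) :
    ‖ω.normalizedTranslate f h φ‖ = (ω h)⁻¹ * ‖f (K1.translate h φ)‖ := by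
  rw [normalizedTranslate_apply, norm_smul, Real.norm_of_nonneg (inv_nonneg.2 (ω.pos' h).le)]

/-- The reciprocal of an exponentially moderate weight grows at most exponentially. -/
lemma exists_inv_le : ∃ (C : ℝ) (a : ℝ), 0 ≤ C ∧ 0 ≤ a ∧
    ∀ h, (ω h)⁻¹ ≤ C * Real.exp (a * ‖h‖) := by
  obtain ⟨A, hA, a, ha, hω⟩ := ω.moderate'
  have h0 := ω.pos' 0
  refine ⟨A / ω 0, a, by positivity, ha, fun h => ?_⟩
  have h1 : ω 0 ≤ A * ω h * Real.exp (a * ‖h‖) := by simpa using hω (-h) h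
  have h2 := ω.pos' h
  rw [inv_le_iff_one_le_mul₀ h2, div_mul_eq_mul_div, div_mul_eq_mul_div, one_le_div h0]
  linarith

/-- The norms of `T_h φ` in `𝒟_{L¹_ω}` grow at most like `ω(h)`. -/
lemma exists_normFamily_translate_le (N : ℕ) : ∃ (k : ℕ) (C : ℝ), 0 ≤ C ∧ ∀ h φ,
    DL1.normFamily ω N (ω.inclusion (K1.translate h φ)) ≤ ω h * (C * K1.nu n k φ) := by
  obtain ⟨A, hA, a, ha, hω⟩ := ω.moderate'
  set k := ⌈a⌉₊ + (n + 1) + N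
  have hk : a + (n + 1 : ℕ) ≤ k := by
    have := Nat.le_ceil a
    simp only [k]
    push_cast
    linarith [(Nat.cast_nonneg N : (0 : ℝ) ≤ N)]
  have hb : 0 ≤ ∫ t, bracket n t := integral_nonneg fun t => (bracket_pos t).le
  refine ⟨k, A * ∫ t, bracket n t, by positivity, fun h φ => ?_⟩
  have hν := apply_nonneg (K1.nu n k) φ
  have hωh := ω.pos' h
  refine Seminorm.finset_sup_apply_le (by positivity) fun m hm => ?_
  have hm' : m ≤ k := by
    have := Finset.mem_range.1 hm
    omega
  change ∫ t, ‖iteratedFDeriv ℝ m (fun t => φ (t - h)) t‖ * ω t ≤ _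
  have hle : ∀ t, ‖iteratedFDeriv ℝ m (fun t => φ (t - h)) t‖ * ω t ≤
      ω h * (A * K1.nu n k φ) * bracket n (t - h) := by
    intro t
    have h1 := K1.norm_iteratedFDeriv_le hm' φ (t - h)
    have h2 : ω t ≤ A * ω h * Real.exp (a * ‖t - h‖) := by
      have := hω (t - h) h
      rwa [sub_add_cancel] at this
    have hωt := ω.pos' t
    rw [iteratedFDeriv_comp_sub]
    calc _ ≤ (K1.nu n k φ * Real.exp (-(k * ‖t - h‖))) *
          (A * ω h * Real.exp (a * ‖t - h‖)) := by gcongr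
      _ = ω h * (A * K1.nu n k φ) * Real.exp (-((k - a) * ‖t - h‖)) := by
        rw [show -(((k : ℝ) - a) * ‖t - h‖) = -(k * ‖t - h‖) + a * ‖t - h‖ by ring, Real.exp_add]
        ring
      _ ≤ _ := by
        gcongr
        exact exp_neg_le_bracket (by linarith) _
  refine (integral_mono_of_nonneg
    (Eventually.of_forall fun t => mul_nonneg (norm_nonneg _) (ω.pos' t).le)
    (((integrable_bracket_fun n).comp_sub_right h).const_mul _)
    (Eventually.of_forall hle)).trans (le_of_eq ?_)
  rw [integral_const_mul, integral_sub_right_eq_self (bracket n)]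
  ring

lemma isVonNBounded_normalizedTranslate_restrict (g : ω.BDual) :
    Bornology.IsVonNBounded ℂ (Set.range (ω.normalizedTranslate (ω.restrict g))) := by
  obtain ⟨N, C, hC, hg⟩ :=
    (DL1.withSeminorms ω).exists_norm_le_of_mono (DL1.normFamily_mono ω) g
  obtain ⟨k, C', hC', hN⟩ := ω.exists_normFamily_translate_le N
  refine ContinuousLinearMap.isVonNBounded_range_iff.2 fun S hS => ?_
  obtain ⟨r, hr, hSr⟩ := (K1.withSeminorms n).isVonNBounded_iff_seminorm_bounded.1 hS k
  refine ⟨C * (C' * r), fun h φ hφ => ?_⟩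
  have hω := ω.pos' h
  rw [norm_normalizedTranslate_apply, inv_mul_le_iff₀ hω]
  calc _ ≤ C * DL1.normFamily ω N (ω.inclusion (K1.translate h φ)) := hg _
    _ ≤ C * (ω h * (C' * K1.nu n k φ)) := by gcongr; exact hN h φ
    _ ≤ C * (ω h * (C' * r)) := by gcongr; exact (hSr φ hφ).le
    _ = _ := by ring

/-! ### From translates to the short-time Fourier transform -/

/-- `|V_ψ f(x, ξ)| / ω(x)` is the modulus of `T_{-x} f / ω(x)` at the conjugate of `M_ξ ψ`. -/
lemma norm_stft_div (f : K1Dual n) (ψ : K1 n) (x ξ : Rn n) :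
    ‖stft ψ f x ξ‖ / ω x = ‖ω.normalizedTranslate f x (K1.modulate (-ξ) (K1.conj ψ))‖ := by
  have h : K1.conj (K1.modulate ξ (K1.translate x ψ)) =
      K1.character (-ξ) x • K1.translate x (K1.modulate (-ξ) (K1.conj ψ)) := by
    refine DFunLike.ext _ _ fun t => ?_
    have hc : K1.character (-ξ) t = K1.character (-ξ) x * K1.character (-ξ) (t - x) := by
      simp only [K1.character, ← Complex.exp_add, inner_sub_right]
      push_cast
      ring_nf
    rw [K1.conj_apply, K1.modulate_apply, K1.smul_apply, K1.translate_apply, K1.translate_apply,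
      K1.modulate_apply, K1.conj_apply, map_mul, K1.conj_character, hc, mul_assoc]
  rw [norm_normalizedTranslate_apply, stft, h, map_smul, norm_smul, K1.norm_character, one_mul,
    div_eq_inv_mul]

lemma nu_modulate_conj_le (k : ℕ) (ξ : Rn n) (ψ : K1 n) :
    K1.nu n k (K1.modulate (-ξ) (K1.conj ψ)) ≤
      (4 * Real.pi) ^ k * K1.nu n k ψ * (1 + ‖ξ‖) ^ k := by
  refine (K1.nu_modulate_le k _ _).trans (le_of_eq ?_)
  rw [K1.nu_conj, norm_neg, mul_pow]
  ring

/-- The equicontinuity of the normalized translates, applied to the functions `M_{-ξ} conj ψ`, whose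
norms grow polynomially in `ξ`. -/
lemma exists_norm_stft_div_le {f : K1Dual n}
    (hf : Bornology.IsVonNBounded ℂ (Set.range (ω.normalizedTranslate f))) (ψ : K1 n) :
    ∃ (k : ℕ) (C : ℝ), 0 ≤ C ∧ ∀ x ξ, ‖stft ψ f x ξ‖ / ω x ≤ C * (1 + ‖ξ‖) ^ k := by
  obtain ⟨k, C, hC, h⟩ := (K1.withSeminorms n).exists_norm_le_of_isVonNBounded
    (fun _ _ h φ => K1.nu_mono h φ) hf
  have hpi := Real.pi_pos
  refine ⟨k, C * ((4 * Real.pi) ^ k * K1.nu n k ψ), by positivity, fun x ξ => ?_⟩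
  rw [norm_stft_div, mul_assoc]
  refine (h _ _).trans (mul_le_mul_of_nonneg_left ?_ hC)
  exact nu_modulate_conj_le k ξ ψ

lemma rpow_neg_mul_pow_le {ξ : Rn n} {k l : ℕ} (h : k ≤ l) :
    (1 + ‖ξ‖) ^ (-(l : ℝ)) * (1 + ‖ξ‖) ^ k ≤ 1 := by
  have h1 : 1 ≤ 1 + ‖ξ‖ := by linarith [norm_nonneg ξ]
  rw [Real.rpow_neg (by positivity), Real.rpow_natCast, inv_mul_le_iff₀ (by positivity), mul_one]
  exact pow_le_pow_right₀ h1 h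

lemma le_mul_pow_of_rpow_neg_mul_le {s M v : ℝ} (hM : 0 ≤ M) {x ξ : Rn n}
    (h : (1 + ‖ξ‖) ^ (-s) * (v / ω x) ≤ M) : v ≤ M * (ω x * (1 + ‖ξ‖) ^ ⌈s⌉₊) := by
  have h1 : 1 ≤ 1 + ‖ξ‖ := by linarith [norm_nonneg ξ]
  have hω := ω.pos' x
  rw [Real.rpow_neg (by positivity), inv_mul_le_iff₀ (by positivity), div_le_iff₀ hω] at h
  refine h.trans ?_
  have h2 : (1 + ‖ξ‖) ^ s ≤ (1 + ‖ξ‖) ^ ⌈s⌉₊ := by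
    rw [← Real.rpow_natCast]
    exact Real.rpow_le_rpow_of_exponent_le h1 (Nat.le_ceil s)
  calc _ = M * (ω x * (1 + ‖ξ‖) ^ s) := by ring
    _ ≤ _ := by gcongr

/-! ### From the short-time Fourier transform to `ℬ'_ω` and `ℬ̇'_ω` -/

/-- A distribution is recovered, as an `ω`-bounded distribution, from its short-time Fourier
transform. -/
lemma exists_restrict_eq {f : K1Dual n} {ψ γ : K1 n} (hγ : HasCompactSupport γ)
    (hγψ : ∫ y, γ y * (starRingEnd ℂ) (ψ y) ≠ 0) {s : ℕ} {M : ℝ}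
    (hM : ∀ x ξ, ‖stft ψ f x ξ‖ ≤ M * (ω x * (1 + ‖ξ‖) ^ s)) :
    ∃ g : ω.BDual, ω.restrict g = f ∧ ∀ θ, g θ =
      ∫ p : Rn n × Rn n, (∫ y, γ y * (starRingEnd ℂ) (ψ y))⁻¹ * stft ψ f p.1 p.2 *
        K1.coeff γ θ p := by
  set κ := ∫ y, γ y * (starRingEnd ℂ) (ψ y)
  obtain ⟨N, C, hC, h⟩ := K1.exists_synthesis ω hγ s
  obtain ⟨g, hg, -⟩ := h (fun p => κ⁻¹ * stft ψ f p.1 p.2) (‖κ⁻¹‖ * M)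
    ((K1.continuous_stft ψ f).const_mul _).aestronglyMeasurable fun p => by
      rw [norm_mul, mul_assoc]
      exact mul_le_mul_of_nonneg_left (hM _ _) (norm_nonneg _)
  refine ⟨g, ?_, hg⟩
  ext φ
  change g (ω.inclusion φ) = f φ
  rw [hg]
  change ∫ p : Rn n × Rn n, κ⁻¹ * stft ψ f p.1 p.2 * K1.coeff γ φ p = _
  simp only [mul_assoc]
  rw [integral_const_mul, K1.integral_stft_mul_coeff hγ ψ φ f, inv_mul_cancel_left₀ hγψ]

/-- Synthesis functionals of continuous functions that are small at infinity on phase space are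
limits of test functions. -/
lemma mem_closure_range_ofTestFunction {γ : K1 n} (hγ : HasCompactSupport γ)
    {V : Rn n × Rn n → ℂ} (hV : Continuous V) {s : ℕ} {M : ℝ}
    (hM : ∀ p, ‖V p‖ ≤ M * (ω p.1 * (1 + ‖p.2‖) ^ s))
    (h0 : ∀ δ > 0, ∀ᶠ p in cocompact (Rn n × Rn n), ‖V p‖ ≤ δ * (ω p.1 * (1 + ‖p.2‖) ^ s))
    {g : ω.BDual} (hg : ∀ θ, g θ = ∫ p, V p * K1.coeff γ θ p) :
    g ∈ closure (Set.range ω.ofTestFunction) := by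
  choose χ hχ using fun R : ℕ => K1.exists_testFunction_eq_synthesis ω hγ hV R
  obtain ⟨N, C, hC, h⟩ := K1.exists_integral_mul_coeff_le ω hγ s
  have hw : ∀ p : Rn n × Rn n, 0 ≤ ω p.1 * (1 + ‖p.2‖) ^ s := fun p => by
    have := ω.pos' p.1
    positivity
  have hK : ∀ R : ℕ, MeasurableSet (Metric.closedBall (0 : Rn n × Rn n) R) := fun R =>
    Metric.isClosed_closedBall.measurableSet
  -- The difference is the synthesis functional of the part of `V` outside the ball of radius `R`,
  -- which is bounded by a small multiple of a fixed norm.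
  have hsub : Tendsto (fun R => g - ω.ofTestFunction (χ R)) atTop (𝓝 0) := by
    refine ContinuousLinearMap.tendsto_zero_iff_forall_isVonNBounded.2 fun S hS ε hε => ?_
    obtain ⟨r, hr, hSr⟩ := (DL1.withSeminorms ω).isVonNBounded_iff_seminorm_bounded.1 hS N
    set δ := ε / (C * r + 1)
    have hδ : 0 < δ := by positivity
    obtain ⟨R₀, -, hR₀⟩ := (hasBasis_cocompact_closedBall (0 : Rn n × Rn n)).eventually_iff.1
      (h0 δ hδ)
    filter_upwards [eventually_ge_atTop ⌈R₀⌉₊] with R hR θ hθ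
    have hRR : R₀ ≤ R := (Nat.le_ceil R₀).trans (by exact_mod_cast hR)
    set K := Metric.closedBall (0 : Rn n × Rn n) R
    have h1 := (h V M hV.aestronglyMeasurable hM θ).1
    have h2 := (h (K.indicator V) M (hV.aestronglyMeasurable.indicator (hK R))
      (fun p => (norm_indicator_le_norm_self V p).trans (hM p)) θ).1
    have h3 := (h (Kᶜ.indicator V) δ (hV.aestronglyMeasurable.indicator (hK R).compl)
      (fun p => by
        by_cases hp : p ∈ K
        · simpa [hp] using mul_nonneg hδ.le (hw p)
        · rw [Set.indicator_of_mem (by exact hp)]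
          refine hR₀ fun hp' => hp (Metric.closedBall_subset_closedBall hRR hp')) θ).2
    have he : (g - ω.ofTestFunction (χ R)) θ = ∫ p, Kᶜ.indicator V p * K1.coeff γ θ p := by
      change g θ - ω.ofTestFunction (χ R) θ = _
      rw [hg, hχ, ← integral_sub h1 h2]
      refine integral_congr_ae (Eventually.of_forall fun p => ?_)
      by_cases hp : p ∈ K <;> simp [hp, K] at hp ⊢
    rw [he]
    calc _ ≤ δ * (C * DL1.normFamily ω N θ) := h3
      _ ≤ δ * (C * r) := by gcongr; exact (hSr θ hθ).le
      _ < δ * (C * r + 1) := by gcongr; linarith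
      _ = ε := div_mul_cancel₀ _ (by positivity)
  have hlim : Tendsto (fun R => ω.ofTestFunction (χ R)) atTop (𝓝 g) := by
    have := (tendsto_const_nhds (x := g)).sub hsub
    simpa using this
  exact mem_closure_of_tendsto hlim (Eventually.of_forall fun R => ⟨χ R, rfl⟩)

/-! ### Vanishing at infinity -/

/-- The normalized translates of a test function vanish at infinity. -/
lemma exists_norm_ofTestFunction_translate_le
    (χ : 𝓓((⊤ : TopologicalSpace.Opens (Rn n)), ℂ)) : ∃ (k : ℕ) (C : ℝ), 0 ≤ C ∧
      ∀ h φ, (ω h)⁻¹ * ‖ω.ofTestFunction χ (ω.inclusion (K1.translate h φ))‖ ≤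
        C * K1.nu n k φ * Real.exp (-‖h‖) := by
  obtain ⟨C, a, hC, ha, hω⟩ := ω.exists_inv_le
  set k := ⌈a⌉₊ + 1
  have hk : a + 1 ≤ k := by
    have := Nat.le_ceil a
    simp only [k]
    push_cast
    linarith
  have hcont : Continuous fun t : Rn n => Real.exp (k * ‖t‖) * ‖χ t‖ :=
    (by fun_prop : Continuous fun t : Rn n => Real.exp (k * ‖t‖)).mul χ.continuous.norm
  have hint : Integrable fun t : Rn n => Real.exp (k * ‖t‖) * ‖χ t‖ :=
    hcont.integrable_of_hasCompactSupport χ.hasCompactSupport.norm.mul_left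
  have hI : 0 ≤ ∫ t, Real.exp (k * ‖t‖) * ‖χ t‖ := integral_nonneg fun t => by positivity
  refine ⟨k, C * ∫ t, Real.exp (k * ‖t‖) * ‖χ t‖, by positivity, fun h φ => ?_⟩
  have hν := apply_nonneg (K1.nu n k) φ
  change (ω h)⁻¹ * ‖∫ t, χ t * φ (t - h)‖ ≤ _
  have hle : ∀ t, ‖χ t * φ (t - h)‖ ≤
      K1.nu n k φ * Real.exp (-(k * ‖h‖)) * (Real.exp (k * ‖t‖) * ‖χ t‖) := by
    intro t
    have h1 := K1.norm_apply_le k φ (t - h)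
    have h2 : ‖h‖ - ‖t‖ ≤ ‖t - h‖ := by
      rw [norm_sub_rev]
      exact norm_sub_norm_le h t
    have h3 : Real.exp (-(k * ‖t - h‖)) ≤ Real.exp (-(k * ‖h‖)) * Real.exp (k * ‖t‖) := by
      rw [← Real.exp_add]
      gcongr
      nlinarith [(Nat.cast_nonneg k : (0 : ℝ) ≤ k)]
    rw [norm_mul]
    calc _ ≤ ‖χ t‖ * (K1.nu n k φ * (Real.exp (-(k * ‖h‖)) * Real.exp (k * ‖t‖))) := by
          gcongr
          exact h1.trans (by gcongr)
      _ = _ := by ring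
  have hmain := norm_integral_le_of_norm_le (hint.const_mul _) (Eventually.of_forall hle)
  rw [integral_const_mul] at hmain
  have hexp : Real.exp (a * ‖h‖) * Real.exp (-(k * ‖h‖)) ≤ Real.exp (-‖h‖) := by
    rw [← Real.exp_add]
    gcongr
    nlinarith [norm_nonneg h]
  calc _ ≤ (C * Real.exp (a * ‖h‖)) * (K1.nu n k φ * Real.exp (-(k * ‖h‖)) *
        ∫ t, Real.exp (k * ‖t‖) * ‖χ t‖) := by
        gcongr
        exact hω h
    _ = C * (∫ t, Real.exp (k * ‖t‖) * ‖χ t‖) * K1.nu n k φ *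
        (Real.exp (a * ‖h‖) * Real.exp (-(k * ‖h‖))) := by ring
    _ ≤ _ := by gcongr

/-- For `f ∈ ℬ̇'_ω` the normalized translates vanish at infinity in the strong topology. -/
lemma tendsto_normalizedTranslate_restrict {g : ω.BDual}
    (hg : g ∈ closure (Set.range ω.ofTestFunction)) :
    Tendsto (ω.normalizedTranslate (ω.restrict g)) (cocompact (Rn n)) (𝓝 0) := by
  refine ContinuousLinearMap.tendsto_zero_iff_forall_isVonNBounded.2 fun S hS ε hε => ?_
  have hSr := (K1.withSeminorms n).isVonNBounded_iff_seminorm_bounded.1 hS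
  -- The normalized translates of the elements of `S` form a bounded subset of `𝒟_{L¹_ω}`, on which
  -- `g` is uniformly close to a test function.
  let B : Set (DL1 ω) := {θ | ∃ h, ∃ φ ∈ S, θ = (((ω h)⁻¹ : ℝ) : ℂ) •
    ω.inclusion (K1.translate h φ)}
  have hnorm : ∀ h, ‖(((ω h)⁻¹ : ℝ) : ℂ)‖ = (ω h)⁻¹ := fun h => by
    rw [Complex.norm_real, Real.norm_of_nonneg (inv_nonneg.2 (ω.pos' h).le)]
  have hB : Bornology.IsVonNBounded ℂ B := by
    refine (DL1.withSeminorms ω).isVonNBounded_iff_seminorm_bounded.2 fun N => ?_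
    obtain ⟨k, C, hC, hN⟩ := ω.exists_normFamily_translate_le N
    obtain ⟨r, hr, hr'⟩ := hSr k
    refine ⟨C * r + 1, by positivity, ?_⟩
    rintro _ ⟨h, φ, hφ, rfl⟩
    have hω := ω.pos' h
    rw [map_smul_eq_mul, hnorm, inv_mul_lt_iff₀ hω]
    refine (hN h φ).trans_lt ?_
    have := mul_le_mul_of_nonneg_left (hr' φ hφ).le hC
    gcongr
    linarith
  have hev : ∀ᶠ g' in 𝓝 g, ∀ θ ∈ B, ‖(g - g') θ‖ < ε / 2 := by
    have ht : Tendsto (fun g' => g - g') (𝓝 g) (𝓝 0) := by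
      have := (tendsto_const_nhds (x := g)).sub (tendsto_id (x := 𝓝 g))
      simpa using this
    exact ContinuousLinearMap.tendsto_zero_iff_forall_isVonNBounded.1 ht B hB _ (by positivity)
  obtain ⟨_, ⟨χ, rfl⟩, hχ⟩ := ((mem_closure_iff_frequently.1 hg).and_eventually hev).exists
  obtain ⟨k, C, hC, hk⟩ := ω.exists_norm_ofTestFunction_translate_le χ
  obtain ⟨r, hr, hr'⟩ := hSr k
  have hexp : Tendsto (fun h : Rn n => C * r * Real.exp (-‖h‖)) (cocompact (Rn n)) (𝓝 0) := by
    have := (Real.tendsto_exp_neg_atTop_nhds_zero.comp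
      (tendsto_norm_cocompact_atTop (E := Rn n))).const_mul (C * r)
    simpa using this
  filter_upwards [hexp.eventually (gt_mem_nhds (half_pos hε))] with h hh φ hφ
  have h1 := hχ _ ⟨h, φ, hφ, rfl⟩
  rw [map_smul, norm_smul, hnorm] at h1
  have hω := ω.pos' h
  have h2 : ‖ω.restrict g (K1.translate h φ)‖ ≤
      ‖(g - ω.ofTestFunction χ) (ω.inclusion (K1.translate h φ))‖ +
        ‖ω.ofTestFunction χ (ω.inclusion (K1.translate h φ))‖ := by
    refine le_trans (le_of_eq ?_) (norm_add_le _ _)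
    congr 1
    exact (sub_add_cancel (g (ω.inclusion (K1.translate h φ))) _).symm
  rw [norm_normalizedTranslate_apply]
  calc _ ≤ (ω h)⁻¹ * (‖(g - ω.ofTestFunction χ) (ω.inclusion (K1.translate h φ))‖ +
        ‖ω.ofTestFunction χ (ω.inclusion (K1.translate h φ))‖) := by gcongr
    _ < ε / 2 + ε / 2 := by
      rw [mul_add]
      refine add_lt_add_of_lt_of_le h1 ((hk h φ).trans (le_trans ?_ hh.le))
      have := hr' φ hφ
      gcongr
    _ = ε := add_halves ε

/-- For `h` in a compact set the normalized translates are bounded, because `f` is continuous and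
`1/ω` is locally bounded. -/
lemma isVonNBounded_of_tendsto {f : K1Dual n}
    (hf : Tendsto (ω.normalizedTranslate f) (cocompact (Rn n)) (𝓝 0)) :
    Bornology.IsVonNBounded ℂ (Set.range (ω.normalizedTranslate f)) := by
  refine ContinuousLinearMap.isVonNBounded_range_iff.2 fun S hS => ?_
  have hev := ContinuousLinearMap.tendsto_zero_iff_forall_isVonNBounded.1 hf S hS 1 one_pos
  obtain ⟨R, -, hR⟩ := (hasBasis_cocompact_closedBall (0 : Rn n)).eventually_iff.1 hev
  obtain ⟨C, a, hC, ha, hω⟩ := ω.exists_inv_le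
  obtain ⟨k, D, hD, hfk⟩ := f.exists_bound
  obtain ⟨r, hr, hSr⟩ := (K1.withSeminorms n).isVonNBounded_iff_seminorm_bounded.1 hS k
  refine ⟨max 1 ((C * Real.exp (a * R)) * (D * (Real.exp (k * R) * r))), fun h φ hφ => ?_⟩
  by_cases hh : h ∈ Metric.closedBall 0 R
  · refine le_max_of_le_right ?_
    rw [mem_closedBall_zero_iff] at hh
    rw [norm_normalizedTranslate_apply]
    have h1 : (ω h)⁻¹ ≤ C * Real.exp (a * R) := (hω h).trans (by gcongr)
    have h2 : ‖f (K1.translate h φ)‖ ≤ D * (Real.exp (k * R) * r) := by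
      refine (hfk _).trans (mul_le_mul_of_nonneg_left ?_ hD)
      refine (K1.nu_translate_le k h φ).trans ?_
      have := (hSr φ hφ).le
      gcongr
    gcongr
  · exact le_max_of_le_left (hR hh φ hφ).le

lemma tendsto_stft_of_tendsto {f : K1Dual n}
    (hf : Tendsto (ω.normalizedTranslate f) (cocompact (Rn n)) (𝓝 0)) (ψ : K1 n) :
    ∃ s : ℝ, Tendsto (fun p : Rn n × Rn n =>
      (1 + ‖p.2‖) ^ (-s) * (‖stft ψ f p.1 p.2‖ / ω p.1)) (cocompact (Rn n × Rn n)) (𝓝 0) := by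
  obtain ⟨k, C, hC, h⟩ := ω.exists_norm_stft_div_le (ω.isVonNBounded_of_tendsto hf) ψ
  refine ⟨(k + 1 : ℕ), ?_⟩
  rw [Metric.tendsto_nhds]
  intro ε hε
  -- For `|ξ| > C / ε` the additional factor `(1 + |ξ|)⁻¹` makes the quotient small; for
  -- `|ξ| ≤ C / ε` the functions `M_{-ξ} conj ψ` form a bounded set, and `x` must be large.
  set R := C / ε
  have hR0 : 0 ≤ R := by positivity
  have hpi := Real.pi_pos
  have hS : Bornology.IsVonNBounded ℂ
      ((fun ξ => K1.modulate (-ξ) (K1.conj ψ)) '' Metric.closedBall 0 R) := by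
    refine (K1.withSeminorms n).isVonNBounded_iff_seminorm_bounded.2 fun j => ?_
    refine ⟨(4 * Real.pi) ^ j * K1.nu n j ψ * (1 + R) ^ j + 1, by positivity, ?_⟩
    rintro _ ⟨ξ, hξ, rfl⟩
    rw [mem_closedBall_zero_iff] at hξ
    refine lt_of_le_of_lt ((nu_modulate_conj_le j ξ ψ).trans ?_) (lt_add_one _)
    gcongr
  have hev := ContinuousLinearMap.tendsto_zero_iff_forall_isVonNBounded.1 hf _ hS ε hε
  obtain ⟨R', -, hR'⟩ := (hasBasis_cocompact_closedBall (0 : Rn n)).eventually_iff.1 hev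
  have hcpt : IsCompact (Metric.closedBall (0 : Rn n) R' ×ˢ Metric.closedBall (0 : Rn n) R) :=
    (isCompact_closedBall _ _).prod (isCompact_closedBall _ _)
  filter_upwards [hcpt.compl_mem_cocompact] with p hp
  obtain ⟨x, ξ⟩ := p
  have hω := ω.pos' x
  have h1 : 1 ≤ 1 + ‖ξ‖ := by linarith [norm_nonneg ξ]
  have hpow : (0 : ℝ) < (1 + ‖ξ‖) ^ (-((k + 1 : ℕ) : ℝ)) := by positivity
  rw [dist_zero_right, Real.norm_of_nonneg (by positivity)]
  simp only
  by_cases hξ : ξ ∈ Metric.closedBall 0 R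
  · have hx : x ∉ Metric.closedBall 0 R' := fun hx => hp ⟨hx, hξ⟩
    have h2 := hR' hx _ ⟨ξ, hξ, rfl⟩
    rw [norm_stft_div]
    have h3 : (1 + ‖ξ‖) ^ (-((k + 1 : ℕ) : ℝ)) ≤ 1 := by
      simpa using rpow_neg_mul_pow_le (ξ := ξ) (Nat.zero_le (k + 1))
    exact (mul_le_of_le_one_left (norm_nonneg _) h3).trans_lt h2
  · rw [mem_closedBall_zero_iff, not_le] at hξ
    have h2 := rpow_neg_mul_pow_le (ξ := ξ) (le_refl (k + 1))
    have h3 : C < ε * (1 + ‖ξ‖) := by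
      have : C = ε * R := by simp only [R]; field_simp
      rw [this]
      gcongr
      linarith
    have hpk : (0 : ℝ) < (1 + ‖ξ‖) ^ k := by positivity
    calc _ ≤ (1 + ‖ξ‖) ^ (-((k + 1 : ℕ) : ℝ)) * (C * (1 + ‖ξ‖) ^ k) := by
          gcongr
          exact h x ξ
      _ < (1 + ‖ξ‖) ^ (-((k + 1 : ℕ) : ℝ)) * (ε * (1 + ‖ξ‖) * (1 + ‖ξ‖) ^ k) := by gcongr
      _ = ε * ((1 + ‖ξ‖) ^ (-((k + 1 : ℕ) : ℝ)) * (1 + ‖ξ‖) ^ (k + 1)) := by ring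
      _ ≤ ε * 1 := by gcongr
      _ = ε := mul_one ε

/-- On compact sets the weighted short-time Fourier transform is bounded, so that its vanishing at
infinity implies its boundedness. -/
lemma bddAbove_of_tendsto_stft {f : K1Dual n} {ψ : K1 n} {s : ℝ}
    (h : Tendsto (fun p : Rn n × Rn n =>
      (1 + ‖p.2‖) ^ (-s) * (‖stft ψ f p.1 p.2‖ / ω p.1)) (cocompact (Rn n × Rn n)) (𝓝 0)) :
    BddAbove (Set.range fun p : Rn n × Rn n =>
      (1 + ‖p.2‖) ^ (-s) * (‖stft ψ f p.1 p.2‖ / ω p.1)) := by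
  obtain ⟨R, -, hR⟩ := (hasBasis_cocompact_closedBall (0 : Rn n × Rn n)).eventually_iff.1
    (h.eventually (gt_mem_nhds one_pos))
  obtain ⟨C, a, hC, ha, hω⟩ := ω.exists_inv_le
  let G : Rn n × Rn n → ℝ := fun p =>
    (1 + ‖p.2‖) ^ (-s) * (‖stft ψ f p.1 p.2‖ * (C * Real.exp (a * ‖p.1‖)))
  have hG : Continuous G := by
    refine Continuous.mul ?_ ((K1.continuous_stft ψ f).norm.mul (by fun_prop))
    exact (by fun_prop : Continuous fun p : Rn n × Rn n => 1 + ‖p.2‖).rpow_const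
      fun p => Or.inl (by positivity)
  obtain ⟨D, hD⟩ := (isCompact_closedBall (0 : Rn n × Rn n) R).bddAbove_image hG.continuousOn
  refine ⟨max 1 D, ?_⟩
  rintro _ ⟨p, rfl⟩
  by_cases hp : p ∈ Metric.closedBall 0 R
  · refine le_max_of_le_right (le_trans ?_ (hD ⟨p, hp, rfl⟩))
    simp only [G, div_eq_mul_inv]
    gcongr
    exact hω p.1
  · exact le_max_of_le_left (hR hp).le

lemma exists_norm_stft_le_of_bddAbove {f : K1Dual n} {ψ : K1 n} {s : ℝ}
    (h : BddAbove (Set.range fun p : Rn n × Rn n =>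
      (1 + ‖p.2‖) ^ (-s) * (‖stft ψ f p.1 p.2‖ / ω p.1))) :
    ∃ M, ∀ x ξ, ‖stft ψ f x ξ‖ ≤ M * (ω x * (1 + ‖ξ‖) ^ ⌈s⌉₊) := by
  obtain ⟨M, hM⟩ := h
  refine ⟨max M 0, fun x ξ => ω.le_mul_pow_of_rpow_neg_mul_le (le_max_right _ _) ?_⟩
  exact (hM ⟨(x, ξ), rfl⟩).trans (le_max_left _ _)

end ExpModerateWeight

theorem mainTheorem3 (n : ℕ) (ω : ExpModerateWeight n) (f : K1Dual n) (ψ : K1 n) (hψ : ψ ≠ 0) :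
    List.TFAE [
      f ∈ ω.boundedDistributions,
      Bornology.IsVonNBounded ℂ
        (Set.range fun h : Rn n => (ω h)⁻¹ • K1Dual.translate (-h) f),
      ∃ s : ℝ, BddAbove (Set.range fun p : Rn n × Rn n =>
        (1 + ‖p.2‖) ^ (-s) * (‖stft ψ f p.1 p.2‖ / ω p.1))] ∧
    List.TFAE [
      f ∈ ω.dotBoundedDistributions,
      Tendsto (fun h : Rn n => (ω h)⁻¹ • K1Dual.translate (-h) f) (cocompact (Rn n)) (𝓝 0),
      ∃ s : ℝ, Tendsto (fun p : Rn n × Rn n =>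
        (1 + ‖p.2‖) ^ (-s) * (‖stft ψ f p.1 p.2‖ / ω p.1)) (cocompact (Rn n × Rn n)) (𝓝 0)] := by
  obtain ⟨γ, hγ, hγψ⟩ := K1.exists_dual_window hψ
  constructor
  · tfae_have 1 → 2 := by
      rintro ⟨g, rfl⟩
      exact ω.isVonNBounded_normalizedTranslate_restrict g
    tfae_have 2 → 3 := by
      intro h
      obtain ⟨k, C, hC, hk⟩ := ω.exists_norm_stft_div_le h ψ
      refine ⟨k, C, ?_⟩
      rintro _ ⟨p, rfl⟩
      calc _ ≤ (1 + ‖p.2‖) ^ (-(k : ℝ)) * (C * (1 + ‖p.2‖) ^ k) := by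
            exact mul_le_mul_of_nonneg_left (hk _ _) (by positivity)
        _ = C * ((1 + ‖p.2‖) ^ (-(k : ℝ)) * (1 + ‖p.2‖) ^ k) := by ring
        _ ≤ C * 1 := by
            exact mul_le_mul_of_nonneg_left (ExpModerateWeight.rpow_neg_mul_pow_le le_rfl) hC
        _ = C := mul_one C
    tfae_have 3 → 1 := by
      rintro ⟨s, h⟩
      obtain ⟨M, hM⟩ := ω.exists_norm_stft_le_of_bddAbove h
      obtain ⟨g, hg, -⟩ := ω.exists_restrict_eq hγ hγψ hM
      exact ⟨g, hg⟩
    tfae_finish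
  · tfae_have 1 → 2 := by
      rintro ⟨g, hg, rfl⟩
      exact ω.tendsto_normalizedTranslate_restrict hg
    tfae_have 2 → 3 := fun h => ω.tendsto_stft_of_tendsto h ψ
    tfae_have 3 → 1 := by
      rintro ⟨s, h⟩
      obtain ⟨M, hM⟩ := ω.exists_norm_stft_le_of_bddAbove (ω.bddAbove_of_tendsto_stft h)
      obtain ⟨g, hg, hgV⟩ := ω.exists_restrict_eq hγ hγψ hM
      refine ⟨g, ω.mem_closure_range_ofTestFunction hγ
        ((K1.continuous_stft ψ f).const_mul _) (s := ⌈s⌉₊)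
        (M := ‖(∫ y, γ y * (starRingEnd ℂ) (ψ y))⁻¹‖ * M) (fun p => ?_) (fun δ hδ => ?_) hgV, hg⟩
      · rw [norm_mul, mul_assoc]
        exact mul_le_mul_of_nonneg_left (hM _ _) (norm_nonneg _)
      · set κ := ∫ y, γ y * (starRingEnd ℂ) (ψ y)
        have hκ : 0 < ‖κ‖ := norm_pos_iff.2 hγψ
        filter_upwards [h.eventually (gt_mem_nhds (mul_pos hδ hκ))] with p hp
        have := ω.le_mul_pow_of_rpow_neg_mul_le (by positivity) hp.le
        rw [norm_mul, norm_inv, inv_mul_le_iff₀ hκ]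
        exact this.trans_eq (by ring)
    tfae_finish

end
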